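/- Let $K$ be the number of relay antennas, $h_S,h_J,h_D,h_E\in\mathbb C^{K}$, $P_S,P_J,P_{R,\max}>0$, $Q\in\mathbb R$, $0<\varepsilon<1$, and put $\rho_0=P_J/P_S$, $\rho_1=\rho_2=1/P_S$ (noise variances $\sigma_R^2=\sigma_D^2=1$), $h_1=h_S^{*}\otimes h_D$, $h_2=h_J^{*}\otimes h_D$, $h_3=h_S^{*}\otimes h_E$, $h_4=h_J^{*}\otimes h_E$, $H_1=I\otimes h_D$, $H_2=h_S^{*}\otimes I$, $H_3=h_J^{*}\otimes I$, $H_4=I\otimes h_E$, where $I$ is the identity matrix of order $K$ and ${}^*$ is the entrywise complex conjugate. Consider the relaxed semidefinite program in $X\in\mathbb C^{K^2\times K^2}$ and $b,c\in\mathbb R$ (which enter only through $b^2,c^2$): $$\begin{aligned}\max\ &\operatorname{tr}(h_1h_1^\dagger X)\\ \text{s.t. }&\rho_0c^2+\operatorname{tr}(\rho_1H_1H_1^\dagger X)+\rho_2b^2\le 1,\quad X\succeq 0,\\ &\operatorname{tr}(h_2h_2^\dagger X)\le c^2,\quad \operatorname{tr}(h_1h_1^\dagger X)\ge \rho_0c^2/\varepsilon,\\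 &\operatorname{tr}[(P_Sh_3h_3^\dagger+P_Jh_4h_4^\dagger+H_4H_4^\dagger)X]\ge Qb^2,\\ &\operatorname{tr}[(P_SH_2H_2^\dagger+P_JH_3H_3^\dagger+I)X]\le P_{R,\max}b^2,\end{aligned}$$ where the last $I$ is the identity of order $K^2$. If $(X,b,c)$ is an optimal solution of this program, then there is an optimal solution $(X^\star,b^\star,c^\star)$ of it with $\operatorname{rank}X^\star\le 1$, and with $\operatorname{rank}X^\star=1$ if $b\ne0$ and ($K\ge2$ or $Q>0$). It is also an optimal solution of the program with the additional constraint $\operatorname{rank}X\le1$, so that this constraint does not change the optimum. Moreover $(X^\star,b^\star,c^\star)$ can be found in polynomial time: there is a single random access program, the same for all $K$ and all data, which computes it from $h_S,h_J,h_D,h_E,P_S,P_J,P_{R,\max},Q,\varepsilon$ and $(X,b,c)$ in a number of steps bounded by a fixed polynomial in $K$; here a step is an exact arithmetic operation, conjugation, real square root or real comparison, or an elementary operation on indices or memory. -/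

import Mathlib

open scoped Matrix Kronecker ComplexOrder

noncomputable section

/-! ### The relay network and its semidefinite programs -/

/-- The data of the relay network with `K` relay antennas: the channel vectors from the source and
from the jammer to the relay, and from the relay to the information receiver and to the
energy-harvesting receiver; the powers of source and jammer, the power budget of the relay, the
harvesting threshold, and the parameter `ε`. The noise variances are normalised to `1`. -/
structure RelayData (K : ℕ) where
  hS : Fin K → ℂ
  hJ : Fin K → ℂ
  hD : Fin K → ℂ
  hE : Fin K → ℂ
  PS : ℝ
  PJ : ℝ
  PRmax : ℝ
  Q : ℝ
  ε : ℝ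

namespace RelayData

variable {K : ℕ} (D : RelayData K)

/-- A vector as a one-column matrix. -/
abbrev col (v : Fin K → ℂ) : Matrix (Fin K) Unit ℂ := Matrix.replicateCol Unit v

/-- `h₁ = h_S^* ⊗ h_D` -/
def h1 : Matrix (Fin K × Fin K) (Unit × Unit) ℂ := col (star D.hS) ⊗ₖ col D.hD
/-- `h₂ = h_J^* ⊗ h_D` -/
def h2 : Matrix (Fin K × Fin K) (Unit × Unit) ℂ := col (star D.hJ) ⊗ₖ col D.hD
/-- `h₃ = h_S^* ⊗ h_E` -/
def h3 : Matrix (Fin K × Fin K) (Unit × Unit) ℂ := col (star D.hS) ⊗ₖ col D.hE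
/-- `h₄ = h_J^* ⊗ h_E` -/
def h4 : Matrix (Fin K × Fin K) (Unit × Unit) ℂ := col (star D.hJ) ⊗ₖ col D.hE
/-- `H₁ = I ⊗ h_D` -/
def H1 : Matrix (Fin K × Fin K) (Fin K × Unit) ℂ := (1 : Matrix (Fin K) (Fin K) ℂ) ⊗ₖ col D.hD
/-- `H₂ = h_S^* ⊗ I` -/
def H2 : Matrix (Fin K × Fin K) (Unit × Fin K) ℂ :=
  col (star D.hS) ⊗ₖ (1 : Matrix (Fin K) (Fin K) ℂ)
/-- `H₃ = h_J^* ⊗ I` -/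
def H3 : Matrix (Fin K × Fin K) (Unit × Fin K) ℂ :=
  col (star D.hJ) ⊗ₖ (1 : Matrix (Fin K) (Fin K) ℂ)
/-- `H₄ = I ⊗ h_E` -/
def H4 : Matrix (Fin K × Fin K) (Fin K × Unit) ℂ := (1 : Matrix (Fin K) (Fin K) ℂ) ⊗ₖ col D.hE

/-- `ρ₀ = P_J / P_S` -/
def ρ₀ : ℝ := D.PJ / D.PS
/-- `ρ₁ = σ_R² / P_S` with `σ_R² = 1` -/
def ρ₁ : ℝ := 1 / D.PS
/-- `ρ₂ = σ_D² / P_S` with `σ_D² = 1` -/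
def ρ₂ : ℝ := 1 / D.PS

/-- The beamforming variable: a square matrix of order `K²`, indexed as a Kronecker product. -/
abbrev Var (K : ℕ) : Type := Matrix (Fin K × Fin K) (Fin K × Fin K) ℂ

/-- The objective `tr(h₁ h₁† X)` (a real number when `X` is Hermitian). -/
def objective (X : Var K) : ℝ := (D.h1 * D.h1ᴴ * X).trace.re

/-- The feasible points `(X, b, c)` of the relaxed semidefinite program; `b` and `c` enter only
through `b²` and `c²`. -/
structure RelaxedFeasible (X : Var K) (b c : ℝ) : Prop where
  psd : X.PosSemidef
  normalisation :
    D.ρ₀ * c ^ 2 + (((D.ρ₁ : ℂ) • (D.H1 * D.H1ᴴ)) * X).trace.re + D.ρ₂ * b ^ 2 ≤ 1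
  jammer : (D.h2 * D.h2ᴴ * X).trace.re ≤ c ^ 2
  source : D.ρ₀ * c ^ 2 / D.ε ≤ (D.h1 * D.h1ᴴ * X).trace.re
  harvest : D.Q * b ^ 2 ≤
    (((D.PS : ℂ) • (D.h3 * D.h3ᴴ) + (D.PJ : ℂ) • (D.h4 * D.h4ᴴ) + D.H4 * D.H4ᴴ) * X).trace.re
  power :
    (((D.PS : ℂ) • (D.H2 * D.H2ᴴ) + (D.PJ : ℂ) • (D.H3 * D.H3ᴴ) + 1) * X).trace.re
      ≤ D.PRmax * b ^ 2

/-- The feasible points of the program with the rank constraint. -/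
def RankFeasible (X : Var K) (b c : ℝ) : Prop := D.RelaxedFeasible X b c ∧ X.rank ≤ 1

/-- `(X, b, c)` is an optimal solution of the relaxed program. -/
def RelaxedOptimal (X : Var K) (b c : ℝ) : Prop :=
  D.RelaxedFeasible X b c ∧
    ∀ (X' : Var K) (b' c' : ℝ), D.RelaxedFeasible X' b' c' → D.objective X' ≤ D.objective X

/-- `(X, b, c)` is an optimal solution of the program with the rank constraint. -/
def RankOptimal (X : Var K) (b c : ℝ) : Prop :=
  D.RankFeasible X b c ∧
    ∀ (X' : Var K) (b' c' : ℝ), D.RankFeasible X' b' c' → D.objective X' ≤ D.objective X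

end RelayData

/-! ### A random access machine with exact arithmetic and a step count

The machine has index registers holding natural numbers and two-dimensional arrays of scalars.
A scalar is a complex number, that is, a pair of real numbers; arithmetic, conjugation, the square
root of a real number and the comparison of two real numbers take one step each, as do an operation
on index registers, an array access, an assignment, a branch and a loop round. A program is a fixed
finite text that does not depend on the size of the input. The bound of a loop is evaluated on
entry, so every program halts; programs that halt within a polynomially long time on a machine with
unbounded loops can be written in this form. -/

namespace RAM

/-- A memory state: index registers, and named two-dimensional arrays of scalars. -/
structure State where
  reg : ℕ → ℕ
  mem : ℕ → ℕ → ℕ → ℂ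

/-- Expressions for indices. -/
inductive IdxExpr where
  | const (n : ℕ)
  | reg (x : ℕ)
  | add (e f : IdxExpr)
  | sub (e f : IdxExpr)

/-- The value of an index expression (subtraction is truncated). -/
def IdxExpr.eval (σ : State) : IdxExpr → ℕ
  | const n => n
  | reg x => σ.reg x
  | add e f => e.eval σ + f.eval σ
  | sub e f => e.eval σ - f.eval σ

/-- The number of steps that the evaluation takes. -/
def IdxExpr.cost : IdxExpr → ℕ
  | const _ => 1
  | reg _ => 1
  | add e f => e.cost + f.cost + 1
  | sub e f => e.cost + f.cost + 1

/-- Expressions for scalars. -/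
inductive Expr where
  | const (q : ℚ)
  | imagUnit
  | get (a : ℕ) (i j : IdxExpr)
  | add (e f : Expr)
  | sub (e f : Expr)
  | mul (e f : Expr)
  | div (e f : Expr)
  | conj (e : Expr)
  | sqrt (e : Expr)

/-- The value of a scalar expression; `sqrt` takes the real part of its argument and returns its
nonnegative square root (`0` for a negative number), and division by `0` returns `0`. -/
def Expr.eval (σ : State) : Expr → ℂ
  | const q => (q : ℂ)
  | imagUnit => Complex.I
  | get a i j => σ.mem a (i.eval σ) (j.eval σ)
  | add e f => e.eval σ + f.eval σ
  | sub e f => e.eval σ - f.eval σ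
  | mul e f => e.eval σ * f.eval σ
  | div e f => e.eval σ / f.eval σ
  | conj e => star (e.eval σ)
  | sqrt e => ((Real.sqrt (e.eval σ).re : ℝ) : ℂ)

/-- The number of steps that the evaluation takes. -/
def Expr.cost : Expr → ℕ
  | const _ => 1
  | imagUnit => 1
  | get _ i j => i.cost + j.cost + 1
  | add e f => e.cost + f.cost + 1
  | sub e f => e.cost + f.cost + 1
  | mul e f => e.cost + f.cost + 1
  | div e f => e.cost + f.cost + 1
  | conj e => e.cost + 1
  | sqrt e => e.cost + 1

/-- Branching conditions: comparison of indices, and of the real parts of two scalars. -/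
inductive Cond where
  | idxLe (e f : IdxExpr)
  | reLe (e f : Expr)

/-- When a condition holds. -/
def Cond.Holds (σ : State) : Cond → Prop
  | idxLe e f => e.eval σ ≤ f.eval σ
  | reLe e f => (e.eval σ).re ≤ (f.eval σ).re

/-- The number of steps that the evaluation takes. -/
def Cond.cost : Cond → ℕ
  | idxLe e f => e.cost + f.cost + 1
  | reLe e f => e.cost + f.cost + 1

/-- Programs. -/
inductive Prog where
  | skip
  | setReg (x : ℕ) (e : IdxExpr)
  | store (a : ℕ) (i j : IdxExpr) (e : Expr)
  | seq (p q : Prog)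
  | ite (t : Cond) (p q : Prog)
  /-- `for x = 0, …, e - 1 do p` -/
  | loop (x : ℕ) (e : IdxExpr) (p : Prog)

/-- Write a value into an index register. -/
def State.setReg (σ : State) (x n : ℕ) : State where
  reg x' := if x' = x then n else σ.reg x'
  mem := σ.mem

/-- Write a value into an array entry. -/
def State.store (σ : State) (a i j : ℕ) (z : ℂ) : State where
  reg := σ.reg
  mem a' i' j' := if a' = a ∧ i' = i ∧ j' = j then z else σ.mem a' i' j'

open scoped Classical in
/-- The execution of a program from a given state: the final state and the number of steps. -/
def Prog.run : Prog → State → State × ℕ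
  | skip, σ => (σ, 1)
  | setReg x e, σ => (σ.setReg x (e.eval σ), e.cost + 1)
  | store a i j e, σ =>
      (σ.store a (i.eval σ) (j.eval σ) (e.eval σ), i.cost + j.cost + e.cost + 1)
  | seq p q, σ =>
      ((q.run (p.run σ).1).1, (p.run σ).2 + (q.run (p.run σ).1).2)
  | ite t p q, σ =>
      if t.Holds σ then ((p.run σ).1, t.cost + (p.run σ).2 + 1)
      else ((q.run σ).1, t.cost + (q.run σ).2 + 1)
  | loop x e p, σ =>
      Nat.rec (motive := fun _ => State × ℕ) (σ, e.cost + 1)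
        (fun k r => ((p.run (r.1.setReg x k)).1, r.2 + (p.run (r.1.setReg x k)).2 + 1))
        (e.eval σ)

/-- The array holding a vector in its column `0`. -/
def vecArray {K : ℕ} (v : Fin K → ℂ) (i j : ℕ) : ℂ :=
  if h : i < K ∧ j = 0 then v ⟨i, h.1⟩ else 0

/-- The array holding a matrix of order `K²`: the index pair `(i, j)` is stored at position
`K * i + j`. -/
def matArray {K : ℕ} (X : RelayData.Var K) (m n : ℕ) : ℂ :=
  if h : m < K * K ∧ n < K * K then
    X (finProdFinEquiv.symm ⟨m, h.1⟩) (finProdFinEquiv.symm ⟨n, h.2⟩)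
  else 0

/-- The array holding a list of real numbers in its column `0`. -/
def listArray (l : List ℝ) (i j : ℕ) : ℂ :=
  if j = 0 then ((l.getD i 0 : ℝ) : ℂ) else 0

/-- The initial state: register `0` holds `K`, arrays `0` to `3` the channel vectors, array `4` the
parameters `P_S`, `P_J`, `P_{R,max}`, `Q`, `ε`, array `5` the matrix `X` and array `6` the numbers
`b` and `c`; everything else is `0`. -/
def input {K : ℕ} (D : RelayData K) (X : RelayData.Var K) (b c : ℝ) : State where
  reg x := if x = 0 then K else 0
  mem a := match a with
    | 0 => vecArray D.hS
    | 1 => vecArray D.hJ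
    | 2 => vecArray D.hD
    | 3 => vecArray D.hE
    | 4 => listArray [D.PS, D.PJ, D.PRmax, D.Q, D.ε]
    | 5 => matArray X
    | 6 => listArray [b, c]
    | _ => fun _ _ => 0

/-- The state `σ` shows the answer `(X, b, c)`: the matrix in array `7`, at the same positions as in
the input, and the two numbers in array `8`, in positions `(0, 0)` and `(1, 0)`. -/
def State.Shows {K : ℕ} (σ : State) (X : RelayData.Var K) (b c : ℝ) : Prop :=
  (∀ i j : Fin K × Fin K,
    σ.mem 7 (finProdFinEquiv i : Fin (K * K)) (finProdFinEquiv j : Fin (K * K)) = X i j) ∧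
  σ.mem 8 0 0 = (b : ℂ) ∧ σ.mem 8 1 0 = (c : ℂ)

end RAM

end

/-! The squares `b²` and `c²` may be taken as small as the power and jammer constraints allow. What
remains is to maximise `F(X)` subject to `A(X) ≤ 1`, `B(X) ≥ 0`, `C(X) ≥ 0`, where `F`, `A`, `B`,
`C` are the traces against `signalMat`, `budgetMat`, `marginMat`, `surplusMat`, and `A` is positive
definite. Two constraints are homogeneous, so with optimum `o` every positive semidefinite `W`
satisfying them has `F(W) ≤ o A(W)` (`RelaxedOptimal.signal_le`). It therefore suffices to find `u ≠
0` with `B, C ≥ 0` and `F ≥ o A` at `u u†`, and to rescale (`Solves.optimal`).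

The rank is lowered by merging (`Superoptimal.merge`). Put `x = g u + h v` and `y = -conj h u + conj
g v` with `|g|² = 1 + a`, `|h|² = 1 - a`, `ζ = conj g * h`. Then `x x† + y y† = 2 (u u† + v v†)`,
and the change of a Hermitian form from `u u† + v v†` to `x x†` is linear in `(a, Re ζ, Im ζ)`,
which ranges over the unit sphere of `ℝ³`. Some point of the sphere is orthogonal to the two vectors
belonging to `B` and `C`; its sign can be chosen so that `A` does not decrease. Now `B` and `C` take
the same values at `x x†` and `y y†`, so the `y`-half remains feasible and has `F ≤ o A`; as the
average has `F ≥ o A`, the `x`-half has `F ≥ o A` as well. The form `F` thus needs no fourth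
dimension.

To stay within arithmetic and square roots, `X` is decomposed by Cholesky pivoting instead of
eigenvectors. Each of the `K²` rounds splits one vector off the remainder and merges it into the
single vector kept so far (`pivotLoop_holds`).

Since `A` never decreases, the final vector can vanish only if `X = 0`. In that case, if `K ≥ 2` and
`Q ≤ 0`, a vector orthogonal to `h₁` and `h₂` serves (`replaceProg_holds`); if `Q > 0`, harvesting
forces `b = 0`.

The running time is read off the program text: all loop bounds are registers holding `K` or `K²`
that the loops never overwrite (`cost_le_timeBound`, `exists_timeBound_le`). -/

namespace RAM

/-! ### Reasoning about programs: frames, loop invariants and a static bound on the cost -/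

/-- The final state of a program. -/
noncomputable def Prog.exec (p : Prog) (σ : State) : State := (p.run σ).1

/-- The arrays that a program may write. -/
def Prog.arrs : Prog → List ℕ
  | .skip => []
  | .setReg _ _ => []
  | .store a _ _ _ => [a]
  | .seq p q => p.arrs ++ q.arrs
  | .ite _ p q => p.arrs ++ q.arrs
  | .loop _ _ p => p.arrs

/-- The index registers that a program may write. -/
def Prog.regs : Prog → List ℕ
  | .skip => []
  | .setReg x _ => [x]
  | .store _ _ _ _ => []
  | .seq p q => p.regs ++ q.regs
  | .ite _ p q => p.regs ++ q.regs
  | .loop x _ p => x :: p.regs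

theorem exec_setReg (x : ℕ) (e : IdxExpr) (σ : State) :
    (Prog.setReg x e).exec σ = σ.setReg x (e.eval σ) := rfl

theorem exec_store (a : ℕ) (i j : IdxExpr) (e : Expr) (σ : State) :
    (Prog.store a i j e).exec σ = σ.store a (i.eval σ) (j.eval σ) (e.eval σ) := rfl

theorem exec_seq (p q : Prog) (σ : State) : (Prog.seq p q).exec σ = q.exec (p.exec σ) := rfl

theorem exec_ite_pos {t : Cond} {p q : Prog} {σ : State} (h : t.Holds σ) :
    (Prog.ite t p q).exec σ = p.exec σ := by
  simp [Prog.exec, Prog.run, h]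

theorem exec_ite_neg {t : Cond} {p q : Prog} {σ : State} (h : ¬ t.Holds σ) :
    (Prog.ite t p q).exec σ = q.exec σ := by
  simp [Prog.exec, Prog.run, h]

/-- The state after `k` rounds of a loop. -/
noncomputable def rounds (x : ℕ) (p : Prog) (σ : State) : ℕ → State
  | 0 => σ
  | k + 1 => p.exec ((rounds x p σ k).setReg x k)

/-- The step counter never influences the states. Its initial value `c` is left free because the
cost estimate needs the same projection. -/
theorem run_loop_rounds (x : ℕ) (p : Prog) (σ : State) (c k : ℕ) :
    (Nat.rec (motive := fun _ => State × ℕ) (σ, c)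
        (fun k r => ((p.run (r.1.setReg x k)).1, r.2 + (p.run (r.1.setReg x k)).2 + 1)) k).1
      = rounds x p σ k := by
  induction k with
  | zero => rfl
  | succ k ih => simp only [rounds, Prog.exec, ← ih]

theorem exec_loop (x : ℕ) (e : IdxExpr) (p : Prog) (σ : State) :
    (Prog.loop x e p).exec σ = rounds x p σ (e.eval σ) :=
  run_loop_rounds x p σ _ _

theorem exec_mem_of_notMem {p : Prog} {a : ℕ} (h : a ∉ p.arrs) (σ : State) :
    (p.exec σ).mem a = σ.mem a := by
  induction p generalizing σ with
  | skip => rfl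
  | setReg x e => rfl
  | store b i j e =>
    have hb : a ≠ b := by simpa [Prog.arrs] using h
    funext i' j'
    simp [exec_store, State.store, hb]
  | seq p q ihp ihq =>
    simp only [Prog.arrs, List.mem_append, not_or] at h
    rw [exec_seq, ihq h.2, ihp h.1]
  | ite t p q ihp ihq =>
    simp only [Prog.arrs, List.mem_append, not_or] at h
    by_cases ht : t.Holds σ
    · rw [exec_ite_pos ht, ihp h.1]
    · rw [exec_ite_neg ht, ihq h.2]
  | loop x e p ih =>
    rw [exec_loop]
    induction e.eval σ with
    | zero => rfl
    | succ k ihk => rw [rounds, ih h]; exact ihk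

theorem exec_reg_of_notMem {p : Prog} {r : ℕ} (h : r ∉ p.regs) (σ : State) :
    (p.exec σ).reg r = σ.reg r := by
  induction p generalizing σ with
  | skip => rfl
  | setReg x e =>
    have hx : r ≠ x := by simpa [Prog.regs] using h
    simp [exec_setReg, State.setReg, hx]
  | store b i j e => rfl
  | seq p q ihp ihq =>
    simp only [Prog.regs, List.mem_append, not_or] at h
    rw [exec_seq, ihq h.2, ihp h.1]
  | ite t p q ihp ihq =>
    simp only [Prog.regs, List.mem_append, not_or] at h
    by_cases ht : t.Holds σ
    · rw [exec_ite_pos ht, ihp h.1]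
    · rw [exec_ite_neg ht, ihq h.2]
  | loop x e p ih =>
    simp only [Prog.regs, List.mem_cons, not_or] at h
    rw [exec_loop]
    induction e.eval σ with
    | zero => rfl
    | succ k ihk => rw [rounds, ih h.2]; simpa [State.setReg, h.1] using ihk

/-- `τ` agrees with `σ` outside the arrays `as` and the registers `rs`. -/
def Agree (as rs : List ℕ) (σ τ : State) : Prop :=
  (∀ a, a ∉ as → τ.mem a = σ.mem a) ∧ ∀ r, r ∉ rs → τ.reg r = σ.reg r

theorem agree_exec (p : Prog) (σ : State) : Agree p.arrs p.regs σ (p.exec σ) :=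
  ⟨fun _ h => exec_mem_of_notMem h σ, fun _ h => exec_reg_of_notMem h σ⟩

/-- Loop rule for an invariant on the state. -/
theorem loop_inv_state {x : ℕ} {e : IdxExpr} {p : Prog} {σ : State}
    (P : ℕ → State → Prop) (h0 : P 0 σ)
    (hs : ∀ k < e.eval σ, ∀ τ : State, Agree p.arrs (x :: p.regs) σ τ →
      P k τ → P (k + 1) (p.exec (τ.setReg x k))) :
    P (e.eval σ) ((Prog.loop x e p).exec σ) := by
  rw [exec_loop]
  have key : ∀ k ≤ e.eval σ, P k (rounds x p σ k) ∧
      Agree p.arrs (x :: p.regs) σ (rounds x p σ k) := by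
    intro k
    induction k with
    | zero => exact fun _ => ⟨h0, fun _ _ => rfl, fun _ _ => rfl⟩
    | succ k ih =>
      intro hk
      obtain ⟨h1, h2, h3⟩ := ih (by omega)
      refine ⟨hs k (by omega) _ ⟨h2, h3⟩ h1, fun a ha => ?_, fun r hr => ?_⟩
      · rw [rounds, exec_mem_of_notMem ha]; exact h2 a ha
      · have : r ≠ x := fun h => hr (by simp [h])
        rw [rounds, exec_reg_of_notMem (fun h => hr (List.mem_cons_of_mem _ h))]
        simpa [State.setReg, this] using h3 r hr
  exact (key _ le_rfl).1

/-- Loop rule for an invariant on the memory. -/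
theorem loop_inv {x : ℕ} {e : IdxExpr} {p : Prog} {σ : State}
    (P : ℕ → (ℕ → ℕ → ℕ → ℂ) → Prop) (h0 : P 0 σ.mem)
    (hs : ∀ k < e.eval σ, ∀ τ : State, Agree p.arrs (x :: p.regs) σ τ → τ.reg x = k →
      P k τ.mem → P (k + 1) (p.exec τ).mem) :
    P (e.eval σ) ((Prog.loop x e p).exec σ).mem := by
  refine loop_inv_state (fun k τ => P k τ.mem) h0 fun k hk τ hA hP => ?_
  refine hs k hk (τ.setReg x k) ⟨hA.1, fun r hr => ?_⟩ (by simp [State.setReg]) hP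
  have : r ≠ x := fun h => hr (by simp [h])
  simpa [State.setReg, this] using hA.2 r hr

/-- The running time, when every loop has at most `N` rounds. -/
def Prog.timeBound (N : ℕ) : Prog → ℕ
  | .skip => 1
  | .setReg _ e => e.cost + 1
  | .store _ i j e => i.cost + j.cost + e.cost + 1
  | .seq p q => p.timeBound N + q.timeBound N
  | .ite t p q => t.cost + p.timeBound N + q.timeBound N + 1
  | .loop _ e p => e.cost + 1 + N * (p.timeBound N + 1)

/-- The loops are bounded by the values of registers in `B`, and these are not written. -/
def Prog.boundedBy (B : List ℕ) : Prog → Bool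
  | .skip => true
  | .setReg x _ => !B.contains x
  | .store _ _ _ _ => true
  | .seq p q => p.boundedBy B && q.boundedBy B
  | .ite _ p q => p.boundedBy B && q.boundedBy B
  | .loop x (.reg r) p => !B.contains x && B.contains r && p.boundedBy B
  | .loop _ _ _ => false

theorem notMem_regs_of_boundedBy {B : List ℕ} {p : Prog} (h : p.boundedBy B = true) :
    ∀ r ∈ B, r ∉ p.regs := by
  induction p with
  | skip => simp [Prog.regs]
  | setReg x e =>
    simp only [Prog.boundedBy, Bool.not_eq_true', List.contains_eq_mem, decide_eq_false_iff_not] at h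
    intro r hr
    simp only [Prog.regs, List.mem_singleton]
    rintro rfl
    exact h hr
  | store => simp [Prog.regs]
  | seq p q ihp ihq =>
    simp only [Prog.boundedBy, Bool.and_eq_true] at h
    intro r hr
    simp [Prog.regs, ihp h.1 r hr, ihq h.2 r hr]
  | ite t p q ihp ihq =>
    simp only [Prog.boundedBy, Bool.and_eq_true] at h
    intro r hr
    simp [Prog.regs, ihp h.1 r hr, ihq h.2 r hr]
  | loop x e p ih =>
    cases e with
    | reg s =>
      simp only [Prog.boundedBy, Bool.and_eq_true, Bool.not_eq_true', List.contains_eq_mem,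
        decide_eq_false_iff_not, decide_eq_true_eq] at h
      intro r hr
      simp only [Prog.regs, List.mem_cons, not_or]
      exact ⟨fun hx => h.1.1 (hx ▸ hr), ih h.2 r hr⟩
    | _ => simp [Prog.boundedBy] at h

/-- The registers in `B` survive every subprogram, so a bound on their initial values still holds
whenever an inner loop is entered. -/
theorem cost_le_timeBound {B : List ℕ} {N : ℕ} {p : Prog} (h : p.boundedBy B = true) (σ : State)
    (hσ : ∀ r ∈ B, σ.reg r ≤ N) : (p.run σ).2 ≤ p.timeBound N := by
  induction p generalizing σ with
  | skip => exact le_rfl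
  | setReg x e => exact le_rfl
  | store => exact le_rfl
  | seq p q ihp ihq =>
    simp only [Prog.boundedBy, Bool.and_eq_true] at h
    refine Nat.add_le_add (ihp h.1 σ hσ) (ihq h.2 _ fun r hr => ?_)
    exact (exec_reg_of_notMem (notMem_regs_of_boundedBy h.1 r hr) σ).trans_le (hσ r hr)
  | ite t p q ihp ihq =>
    simp only [Prog.boundedBy, Bool.and_eq_true] at h
    have h1 := ihp h.1 σ hσ
    have h2 := ihq h.2 σ hσ
    simp only [Prog.run, Prog.timeBound]
    split_ifs <;> simp only <;> omega
  | loop x e p ih =>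
    cases e with
    | reg s =>
      simp only [Prog.boundedBy, Bool.and_eq_true, Bool.not_eq_true', List.contains_eq_mem,
        decide_eq_false_iff_not, decide_eq_true_eq] at h
      have hreg : ∀ k, ∀ r ∈ B, (rounds x p σ k).reg r ≤ N := by
        intro k
        induction k with
        | zero => exact hσ
        | succ k ihk =>
          intro r hr
          rw [rounds, exec_reg_of_notMem (notMem_regs_of_boundedBy h.2 r hr)]
          have : r ≠ x := fun hx => h.1.1 (hx ▸ hr)
          simpa [State.setReg, this] using ihk r hr
      have key : ∀ c k : ℕ, (Nat.rec (motive := fun _ => State × ℕ) (σ, c)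
          (fun k r => ((p.run (r.1.setReg x k)).1, r.2 + (p.run (r.1.setReg x k)).2 + 1)) k).2
            ≤ c + k * (p.timeBound N + 1) := by
        intro c k
        induction k with
        | zero => simp
        | succ k ihk =>
          have h3 : (p.run ((rounds x p σ k).setReg x k)).2 ≤ p.timeBound N := by
            refine ih h.2 _ fun r hr => ?_
            have : r ≠ x := fun hx => h.1.1 (hx ▸ hr)
            simpa [State.setReg, this] using hreg k r hr
          rw [← run_loop_rounds x p σ c k] at h3
          rw [Nat.succ_mul]
          simp only
          omega
      refine (key _ _).trans ?_
      have : σ.reg s * (p.timeBound N + 1) ≤ N * (p.timeBound N + 1) :=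
        Nat.mul_le_mul_right _ (hσ s h.1.2)
      simp only [Prog.timeBound, IdxExpr.eval]
      omega
    | _ => simp [Prog.boundedBy] at h

/-- A loop raises the degree by one and a sum adds the degrees, so `C` and `d` depend on the program
text alone. -/
theorem exists_timeBound_le (p : Prog) : ∃ C d : ℕ, ∀ N, p.timeBound N ≤ C * (N + 1) ^ d := by
  have hsum : ∀ {f g : ℕ → ℕ}, (∃ C d : ℕ, ∀ N, f N ≤ C * (N + 1) ^ d) →
      (∃ C d : ℕ, ∀ N, g N ≤ C * (N + 1) ^ d) →
      ∃ C d : ℕ, ∀ N, f N + g N ≤ C * (N + 1) ^ d := by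
    rintro f g ⟨C, d, h⟩ ⟨C', d', h'⟩
    refine ⟨C + C', d + d', fun N => ?_⟩
    have h1 : (N + 1) ^ d ≤ (N + 1) ^ (d + d') := Nat.pow_le_pow_right (by omega) (by omega)
    have h2 : (N + 1) ^ d' ≤ (N + 1) ^ (d + d') := Nat.pow_le_pow_right (by omega) (by omega)
    calc f N + g N ≤ C * (N + 1) ^ d + C' * (N + 1) ^ d' := Nat.add_le_add (h N) (h' N)
      _ ≤ C * (N + 1) ^ (d + d') + C' * (N + 1) ^ (d + d') := by gcongr
      _ = _ := by ring
  have hconst : ∀ c : ℕ, ∃ C d : ℕ, ∀ N : ℕ, c ≤ C * (N + 1) ^ d := fun c => ⟨c, 0, by simp⟩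
  induction p with
  | skip => exact hconst _
  | setReg x e => exact hconst _
  | store => exact hconst _
  | seq p q ihp ihq => exact hsum ihp ihq
  | ite t p q ihp ihq => exact hsum (hsum (hsum (hconst _) ihp) ihq) (hconst 1)
  | loop x e p ih =>
    refine hsum (hconst (e.cost + 1)) ?_
    obtain ⟨C, d, h⟩ := hsum ih (hconst 1)
    refine ⟨C, d + 1, fun N => ?_⟩
    calc N * (p.timeBound N + 1) ≤ (N + 1) * (C * (N + 1) ^ d) :=
          Nat.mul_le_mul (by omega) (h N)
      _ = _ := by ring

end RAM

namespace RAM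

/-! ### Loops over vectors and matrices -/

theorem store_mem (σ : State) (a i j : ℕ) (z : ℂ) (a' i' j' : ℕ) :
    (σ.store a i j z).mem a' i' j' = if a' = a ∧ i' = i ∧ j' = j then z else σ.mem a' i' j' := rfl

theorem setReg_reg (σ : State) (x n r : ℕ) :
    (σ.setReg x n).reg r = if r = x then n else σ.reg r := rfl

/-- `for x < reg 1 do a[x, 0] := e` -/
def fillVec (x a : ℕ) (e : Expr) : Prog :=
  .loop x (.reg 1) (.store a (.reg x) (.const 0) e)

/-- The expression may read the entry about to be overwritten, which still has its original value;
this permits updates in place. -/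
theorem fillVec_mem {x a : ℕ} {e : Expr} {σ : State} {f : ℕ → ℂ}
    (he : ∀ i < σ.reg 1, ∀ τ : State, Agree [a] [x] σ τ → τ.reg x = i →
      τ.mem a i 0 = σ.mem a i 0 → e.eval τ = f i) (i j : ℕ) :
    ((fillVec x a e).exec σ).mem a i j = if i < σ.reg 1 ∧ j = 0 then f i else σ.mem a i j := by
  refine loop_inv (e := .reg 1) (fun k m => ∀ i j, m a i j = if i < k ∧ j = 0 then f i
    else σ.mem a i j) (by simp) (fun k hk τ hA hx hP i j => ?_) i j
  have h1 := he k hk τ hA hx (by simp [hP])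
  rw [exec_store, store_mem, h1]
  simp only [IdxExpr.eval, hx, hP, true_and]
  by_cases hi : i = k
  · subst hi; by_cases hj : j = 0 <;> simp [hj]
  · have : i < k + 1 ↔ i < k := by omega
    simp [hi, this]

/-- `for x < reg 1 do for y < reg 1 do a[x, y] := e` -/
def fillMat (x y a : ℕ) (e : Expr) : Prog :=
  .loop x (.reg 1) (.loop y (.reg 1) (.store a (.reg x) (.reg y) e))

theorem fillMat_mem {x y a : ℕ} {e : Expr} {σ : State} {f : ℕ → ℕ → ℂ}
    (hxy : x ≠ y) (hx1 : x ≠ 1) (hy1 : y ≠ 1)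
    (he : ∀ i < σ.reg 1, ∀ j < σ.reg 1, ∀ τ : State, Agree [a] [x, y] σ τ → τ.reg x = i →
      τ.reg y = j → τ.mem a i j = σ.mem a i j → e.eval τ = f i j) (i j : ℕ) :
    ((fillMat x y a e).exec σ).mem a i j =
      if i < σ.reg 1 ∧ j < σ.reg 1 then f i j else σ.mem a i j := by
  refine loop_inv (e := .reg 1) (fun k m => ∀ i j, m a i j = if i < k ∧ j < σ.reg 1 then f i j
    else σ.mem a i j) (by simp) (fun k hk τ hA hx hP i j => ?_) i j
  have hr1 : τ.reg 1 = σ.reg 1 := hA.2 1 (by simp [Prog.regs, hx1.symm, hy1.symm])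
  -- Inner invariant: the rows before `k` are complete, and row `k` is filled up to column `l`.
  have := loop_inv (x := y) (e := .reg 1) (σ := τ) (p := .store a (.reg x) (.reg y) e)
    (fun l m => ∀ i j, m a i j =
    if i < k ∧ j < σ.reg 1 then f i j else if i = k ∧ j < l then f i j else σ.mem a i j)
    (by simpa using hP) (fun l hl τ' hA' hy hP' i j => ?_) i j
  · rw [this]
    simp only [IdxExpr.eval, hr1]
    by_cases hi : i = k
    · subst hi; simp
    · have : i < k + 1 ↔ i < k := by omega
      simp [hi, this]
  · simp only [IdxExpr.eval, hr1] at hl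
    have hx' : τ'.reg x = k := by
      rw [hA'.2 x (by simp [Prog.regs, hxy]), hx]
    have h1 := he k hk l hl τ' ⟨fun b hb => (hA'.1 b hb).trans (hA.1 b hb), fun r hr => ?_⟩ hx' hy
      (by simp [hP'])
    · rw [exec_store, store_mem, h1]
      simp only [IdxExpr.eval, hx', hy, hP', true_and]
      by_cases hi : i = k
      · subst hi
        by_cases hj : j = l
        · subst hj; simp
        · have : j < l + 1 ↔ j < l := by omega
          simp [hj, this]
      · simp [hi]
    · simp only [List.mem_cons, List.not_mem_nil, or_false, not_or] at hr
      rw [hA'.2 r (by simp [Prog.regs, hr]), hA.2 r (by simp [Prog.regs, hr])]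

/-- `t[0, 0] := ∑ x y, conj u[x, 0] * N[x, y] * v[y, 0]` -/
def formProg (x y N u v t : ℕ) : Prog :=
  .seq (.store t (.const 0) (.const 0) (.const 0))
    (.loop x (.reg 1) (.loop y (.reg 1) (.store t (.const 0) (.const 0)
      (.add (.get t (.const 0) (.const 0))
        (.mul (.mul (.conj (.get u (.reg x) (.const 0))) (.get N (.reg x) (.reg y)))
          (.get v (.reg y) (.const 0)))))))

theorem formProg_mem {x y N u v t : ℕ} {σ : State} (hxy : x ≠ y) (hx1 : x ≠ 1) (hy1 : y ≠ 1)
    (hN : N ≠ t) (hu : u ≠ t) (hv : v ≠ t) :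
    ((formProg x y N u v t).exec σ).mem t 0 0 =
      ∑ i ∈ Finset.range (σ.reg 1), ∑ j ∈ Finset.range (σ.reg 1),
        star (σ.mem u i 0) * σ.mem N i j * σ.mem v j 0 := by
  rw [formProg, exec_seq]
  set σ₀ := (Prog.store t (.const 0) (.const 0) (.const 0)).exec σ with hσ₀
  have hA₀ : Agree [t] [] σ σ₀ := agree_exec (Prog.store t (.const 0) (.const 0) (.const 0)) σ
  have h1 : σ₀.reg 1 = σ.reg 1 := rfl
  rw [← h1]
  refine loop_inv (e := .reg 1) (fun k m => m t 0 0 = ∑ i ∈ Finset.range k,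
    ∑ j ∈ Finset.range (σ₀.reg 1), star (σ.mem u i 0) * σ.mem N i j * σ.mem v j 0)
    (by simp [hσ₀, exec_store, store_mem, IdxExpr.eval, Expr.eval]) (fun k hk τ hA hx hP => ?_)
  have hr1 : τ.reg 1 = σ₀.reg 1 := hA.2 1 (by simp [Prog.regs, hx1.symm, hy1.symm])
  rw [Finset.sum_range_succ, ← hP, ← hr1]
  refine loop_inv (e := .reg 1) (fun l m => m t 0 0 = τ.mem t 0 0 + ∑ j ∈ Finset.range l,
    star (σ.mem u k 0) * σ.mem N k j * σ.mem v j 0) (by simp) (fun l hl τ' hA' hy hP' => ?_)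
  have hx' : τ'.reg x = k := by
    rw [hA'.2 x (by simp [Prog.regs, hxy]), hx]
  have hm : ∀ a, a ≠ t → τ'.mem a = σ.mem a := fun a ha => by
    rw [hA'.1 a (by simp [Prog.arrs, ha]), hA.1 a (by simp [Prog.arrs, ha]), hA₀.1 a (by simp [ha])]
  simp [exec_store, store_mem, IdxExpr.eval, Expr.eval, hx', hy, hP', hm u hu, hm v hv, hm N hN,
    Finset.sum_range_succ, add_assoc]

/-- `m := 0; for x < reg 0 do for y < reg 0 do (p; m := m + 1)` -/
def pairLoop (x y m : ℕ) (p : Prog) : Prog :=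
  .seq (.setReg m (.const 0)) (.loop x (.reg 0) (.loop y (.reg 0)
    (.seq p (.setReg m (.add (.reg m) (.const 1))))))

/-- Index expressions have no multiplication, so the linear position `K * i + j` is tracked by the
counter `m`. The invariant depends on that position only, which lets consecutive rows join. -/
theorem pairLoop_inv {x y m : ℕ} {p : Prog} {σ : State} {K : ℕ} (hK : σ.reg 0 = K)
    (hxy : x ≠ y) (hxm : x ≠ m) (hym : y ≠ m) (h0 : 0 ∉ x :: y :: m :: p.regs)
    (hp : x ∉ p.regs ∧ y ∉ p.regs ∧ m ∉ p.regs)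
    (P : ℕ → (ℕ → ℕ → ℕ → ℂ) → Prop) (hP0 : P 0 σ.mem)
    (hs : ∀ i < K, ∀ j < K, ∀ τ : State, Agree p.arrs (x :: y :: m :: p.regs) σ τ →
      τ.reg x = i → τ.reg y = j → τ.reg m = K * i + j → P (K * i + j) τ.mem →
      P (K * i + j + 1) (p.exec τ).mem) :
    P (K * K) ((pairLoop x y m p).exec σ).mem := by
  simp only [List.mem_cons, not_or] at h0
  rw [pairLoop, exec_seq, exec_setReg]
  set σ₀ := σ.setReg m ((IdxExpr.const 0).eval σ) with hσ₀
  have hr : ∀ r, r ≠ m → σ₀.reg r = σ.reg r := fun r hr => by simp [hσ₀, State.setReg, hr]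
  have hK₀ : σ₀.reg 0 = K := by rw [hr 0 h0.2.2.1, hK]
  have h := loop_inv_state (x := x) (e := .reg 0) (σ := σ₀)
    (p := .loop y (.reg 0) (.seq p (.setReg m (.add (.reg m) (.const 1)))))
    (fun i τ => τ.reg m = K * i ∧ P (K * i) τ.mem)
    (by simpa [hσ₀, State.setReg, IdxExpr.eval] using hP0) (fun i hi τ hA hP => ?_)
  · simp only [IdxExpr.eval, hK₀] at h
    exact h.2
  simp only [IdxExpr.eval, hK₀] at hi
  have hK₁ : (τ.setReg x i).reg 0 = K := by
    simp only [State.setReg, h0.1, if_false]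
    rw [hA.2 0 (by simp [Prog.regs, h0]), hK₀]
  have h := loop_inv_state (x := y) (e := .reg 0) (σ := τ.setReg x i)
    (p := .seq p (.setReg m (.add (.reg m) (.const 1))))
    (fun j τ' => τ'.reg m = K * i + j ∧ P (K * i + j) τ'.mem)
    (by simpa [State.setReg, hxm.symm] using hP) (fun j hj τ' hA' hP' => ?_)
  · simp only [IdxExpr.eval, hK₁] at h
    -- The end `K * i + K` of a row is by definition the start `K * (i + 1)` of the next.
    exact h
  simp only [IdxExpr.eval, hK₁] at hj
  have hm : (p.exec (τ'.setReg y j)).reg m = K * i + j := by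
    rw [exec_reg_of_notMem hp.2.2]
    simpa [State.setReg, hym.symm] using hP'.1
  refine ⟨by simp [exec_seq, exec_setReg, setReg_reg, IdxExpr.eval, hm, add_assoc], ?_⟩
  refine hs i hi j hj (τ'.setReg y j) ⟨fun a ha => ?_, fun r hr' => ?_⟩ ?_ (by simp [State.setReg])
    (by simpa [State.setReg, hym.symm] using hP'.1) hP'.2
  · exact (hA'.1 a (by simpa [Prog.arrs] using ha)).trans
      (hA.1 a (by simpa [Prog.arrs] using ha))
  · simp only [List.mem_cons, not_or] at hr'
    have h1 := hA'.2 r (by simp [Prog.regs, hr'])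
    have h2 := hA.2 r (by simp [Prog.regs, hr'])
    simp only [State.setReg, hr', if_false] at h1 ⊢
    rw [h1, h2, hr r hr'.2.2.1]
  · have := hA'.2 x (by simp [Prog.regs, hxy, hxm, hp])
    simpa [State.setReg, hxy] using this

/-- Fill the array `a` with a matrix whose rows and columns are indexed by pairs: the row has
indices in registers `2` and `3`, the column in registers `4` and `5`. -/
def fillKron (a : ℕ) (e : Expr) : Prog :=
  pairLoop 2 3 6 (pairLoop 4 5 7 (.store a (.reg 6) (.reg 7) e))

theorem mul_add_inj {K i j i' j' : ℕ} (hj : j < K) (hj' : j' < K) (h : K * i + j = K * i' + j') :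
    i = i' ∧ j = j' := by
  have hK : 0 < K := by omega
  have h1 : (K * i + j) / K = i := by rw [Nat.mul_add_div hK, Nat.div_eq_of_lt hj, add_zero]
  have h2 : (K * i' + j') / K = i' := by rw [Nat.mul_add_div hK, Nat.div_eq_of_lt hj', add_zero]
  have h3 : i = i' := by rw [← h1, ← h2, h]
  subst h3
  exact ⟨rfl, by omega⟩

theorem fillKron_mem {a : ℕ} {e : Expr} {σ : State} {K : ℕ} {f : ℕ → ℕ → ℕ → ℕ → ℂ}
    (hK : σ.reg 0 = K)
    (he : ∀ i < K, ∀ j < K, ∀ k < K, ∀ l < K, ∀ τ : State, (∀ b, b ≠ a → τ.mem b = σ.mem b) →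
      τ.reg 2 = i → τ.reg 3 = j → τ.reg 4 = k → τ.reg 5 = l → e.eval τ = f i j k l)
    {i j k l : ℕ} (hi : i < K) (hj : j < K) (hk : k < K) (hl : l < K) :
    ((fillKron a e).exec σ).mem a (K * i + j) (K * k + l) = f i j k l := by
  have hlt : ∀ {i j : ℕ}, i < K → j < K → K * i + j < K * K := fun {i j} hi hj => by
    calc K * i + j < K * i + K := by omega
      _ = K * (i + 1) := by ring
      _ ≤ K * K := Nat.mul_le_mul_left _ hi
  refine pairLoop_inv (x := 2) (y := 3) (m := 6)
    (p := pairLoop 4 5 7 (.store a (.reg 6) (.reg 7) e)) hK (by decide) (by decide)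
    (by decide) (by simp [pairLoop, Prog.regs]) (by simp [pairLoop, Prog.regs])
    (fun s m => ∀ i < K, ∀ j < K, ∀ k < K, ∀ l < K, K * i + j < s →
      m a (K * i + j) (K * k + l) = f i j k l) (by simp) ?_ i hi j hj k hk l hl (hlt hi hj)
  intro i hi j hj τ hA h2 h3 h6 hP
  have hKτ : τ.reg 0 = K := by rw [hA.2 0 (by simp [pairLoop, Prog.regs]), hK]
  have := pairLoop_inv (x := 4) (y := 5) (m := 7) (p := .store a (.reg 6) (.reg 7) e) hKτ
    (by decide) (by decide) (by decide) (by simp [Prog.regs]) (by simp [Prog.regs])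
    -- The first conjunct preserves the finished rows while the second fills row `K * i + j`.
    (fun s m => (∀ i' < K, ∀ j' < K, ∀ k < K, ∀ l < K, K * i' + j' < K * i + j →
      m a (K * i' + j') (K * k + l) = f i' j' k l) ∧
      ∀ k < K, ∀ l < K, K * k + l < s → m a (K * i + j) (K * k + l) = f i j k l)
    ⟨hP, by simp⟩ ?_
  · intro i' hi' j' hj' k hk l hl hlt'
    by_cases h : K * i' + j' < K * i + j
    · exact this.1 i' hi' j' hj' k hk l hl h
    · obtain ⟨rfl, rfl⟩ := mul_add_inj hj' hj
        (show K * i' + j' = K * i + j by omega)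
      exact this.2 k hk l hl (hlt hk hl)
  · intro k hk l hl τ' hA' h4 h5 h7 hP'
    have h2' : τ'.reg 2 = i := by rw [hA'.2 2 (by simp [Prog.regs]), h2]
    have h3' : τ'.reg 3 = j := by rw [hA'.2 3 (by simp [Prog.regs]), h3]
    have h6' : τ'.reg 6 = K * i + j := by rw [hA'.2 6 (by simp [Prog.regs]), h6]
    have hv := he i hi j hj k hk l hl τ' (fun b hb => by
      rw [hA'.1 b (by simp [Prog.arrs, hb]), hA.1 b (by simp [pairLoop, Prog.arrs, hb])])
      h2' h3' h4 h5
    rw [exec_store, hv]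
    simp only [store_mem, IdxExpr.eval, h6', h7, true_and]
    refine ⟨fun i' hi' j' hj' k' hk' l' hl' h => ?_, fun k' hk' l' hl' h => ?_⟩
    · rw [if_neg (by omega)]; exact hP'.1 i' hi' j' hj' k' hk' l' hl' h
    · by_cases h' : K * k' + l' = K * k + l
      · obtain ⟨rfl, rfl⟩ := mul_add_inj hl' hl h'
        simp
      · rw [if_neg h']; exact hP'.2 k' hk' l' hl' (by omega)

/-- `reg 1 := reg 0 * reg 0` -/
def squareProg : Prog :=
  .seq (.setReg 1 (.const 0)) (.loop 2 (.reg 0) (.setReg 1 (.add (.reg 1) (.reg 0))))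

theorem squareProg_reg (σ : State) : (squareProg.exec σ).reg 1 = σ.reg 0 * σ.reg 0 := by
  rw [squareProg, exec_seq]
  set σ₀ := (Prog.setReg 1 (.const 0)).exec σ with hσ₀
  have h0 : σ₀.reg 0 = σ.reg 0 := by simp [hσ₀, exec_setReg, State.setReg]
  have := loop_inv_state (x := 2) (e := .reg 0) (σ := σ₀)
    (p := .setReg 1 (.add (.reg 1) (.reg 0))) (fun k τ => τ.reg 1 = k * σ.reg 0)
    (by simp [hσ₀, exec_setReg, State.setReg, IdxExpr.eval]) (fun k hk τ hA hP => ?_)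
  · simpa [IdxExpr.eval, h0] using this
  · have : τ.reg 0 = σ.reg 0 := by rw [hA.2 0 (by simp [Prog.regs]), h0]
    simp [exec_setReg, State.setReg, IdxExpr.eval, hP, this, Nat.succ_mul]

end RAM

namespace RelayData

/-! ### Hermitian forms, pivoting and merging of two vectors -/

section Forms

variable {ι : Type*}

/-- The matrix `u u†`. -/
noncomputable def outer (u : ι → ℂ) : Matrix ι ι ℂ := Matrix.vecMulVec u (star u)

theorem outer_apply (u : ι → ℂ) (i j : ι) : outer u i j = u i * star (u j) := rfl

theorem outer_eq_zero {u : ι → ℂ} : outer u = 0 ↔ u = 0 := by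
  simp [outer]

/-- The coefficient matrix with rows `(g, h)` and `(-conj h, conj g)` is `√2` times a unitary one.
-/
theorem outer_combination_add {u v : ι → ℂ} {g h : ℂ}
    (hgh : Complex.normSq g + Complex.normSq h = 2) :
    outer (g • u + h • v) + outer (-star h • u + star g • v) =
      ((2 : ℝ) : ℂ) • (outer u + outer v) := by
  have h2 : g * star g + h * star h = 2 := by
    have := congrArg (fun r : ℝ => (r : ℂ)) hgh
    simpa [Complex.normSq_eq_conj_mul_self, mul_comm] using this
  ext i j
  simp only [outer_apply, Matrix.add_apply, Matrix.smul_apply, Pi.add_apply, Pi.smul_apply,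
    smul_eq_mul, star_add, star_mul', star_neg, star_star, Complex.ofReal_ofNat]
  linear_combination (u i * star (u j) + v i * star (v j)) * h2

/-- The vector split off in a step of the Cholesky factorisation (`0` if the pivot is `0`). -/
noncomputable def pivotVec (Y : Matrix ι ι ℂ) (k : ι) (i : ι) : ℂ :=
  Y i k / ((Real.sqrt (Y k k).re : ℝ) : ℂ)

theorem pivotVec_apply_eq_zero {Y : Matrix ι ι ℂ} {k i : ι} (h : ∀ j, Y i j = 0) :
    pivotVec Y k i = 0 := by simp [pivotVec, h]

/-! ### Trace pairings, sesquilinear forms and merging -/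

variable [Fintype ι]

/-- The real part of `tr(N X)`. -/
noncomputable def pairing (N X : Matrix ι ι ℂ) : ℝ := (N * X).trace.re

/-- The sesquilinear form `u† N v`. -/
noncomputable def sform (N : Matrix ι ι ℂ) (u v : ι → ℂ) : ℂ :=
  ∑ i, ∑ j, star (u i) * N i j * v j

theorem outer_posSemidef (u : ι → ℂ) : (outer u).PosSemidef :=
  Matrix.posSemidef_vecMulVec_self_star u

theorem pairing_add_left (N N' X : Matrix ι ι ℂ) :
    pairing (N + N') X = pairing N X + pairing N' X := by simp [pairing, add_mul]

theorem pairing_sub_left (N N' X : Matrix ι ι ℂ) :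
    pairing (N - N') X = pairing N X - pairing N' X := by simp [pairing, sub_mul]

theorem pairing_smul_left (r : ℝ) (N X : Matrix ι ι ℂ) :
    pairing ((r : ℂ) • N) X = r * pairing N X := by simp [pairing]

theorem pairing_add_right (N X X' : Matrix ι ι ℂ) :
    pairing N (X + X') = pairing N X + pairing N X' := by simp [pairing, mul_add]

theorem pairing_smul_right (r : ℝ) (N X : Matrix ι ι ℂ) :
    pairing N ((r : ℂ) • X) = r * pairing N X := by simp [pairing]

theorem pairing_zero_right (N : Matrix ι ι ℂ) : pairing N 0 = 0 := by simp [pairing]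

theorem pairing_outer (N : Matrix ι ι ℂ) (u : ι → ℂ) :
    pairing N (outer u) = (sform N u u).re := by
  unfold pairing
  congr 1
  simp only [Matrix.trace, Matrix.diag, Matrix.mul_apply, outer_apply, sform]
  refine Finset.sum_congr rfl fun i _ => Finset.sum_congr rfl fun j _ => ?_
  ring

theorem pairing_mul_conjTranspose_nonneg {κ : Type*} [Fintype κ] (H : Matrix ι κ ℂ)
    {X : Matrix ι ι ℂ} (hX : X.PosSemidef) : 0 ≤ pairing (H * Hᴴ) X := by
  have h := (hX.conjTranspose_mul_mul_same H).trace_nonneg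
  have h2 : (H * Hᴴ * X).trace = (Hᴴ * X * H).trace := by
    rw [Matrix.mul_assoc, Matrix.trace_mul_comm]
  rw [pairing, h2]
  exact (Complex.nonneg_iff.1 h).1

theorem pairing_one_nonneg [DecidableEq ι] {X : Matrix ι ι ℂ} (hX : X.PosSemidef) :
    0 ≤ pairing 1 X := by
  rw [pairing, one_mul]
  exact (Complex.nonneg_iff.1 hX.trace_nonneg).1

theorem eq_zero_of_pairing_one_nonpos [DecidableEq ι] {X : Matrix ι ι ℂ} (hX : X.PosSemidef)
    (h : pairing 1 X ≤ 0) : X = 0 := by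
  rw [pairing, one_mul] at h
  obtain ⟨h1, h2⟩ := Complex.nonneg_iff.1 hX.trace_nonneg
  exact hX.trace_eq_zero_iff.1 (Complex.ext (le_antisymm h h1) h2.symm)

theorem sform_eq_dotProduct (N : Matrix ι ι ℂ) (u v : ι → ℂ) :
    sform N u v = star u ⬝ᵥ N *ᵥ v := by
  simp [sform, dotProduct, Matrix.mulVec, Finset.mul_sum, mul_assoc]

theorem star_sform {N : Matrix ι ι ℂ} (hN : N.IsHermitian) (u v : ι → ℂ) :
    star (sform N u v) = sform N v u := by
  simp only [sform, star_sum, star_mul', star_star]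
  rw [Finset.sum_comm]
  refine Finset.sum_congr rfl fun i _ => Finset.sum_congr rfl fun j _ => ?_
  rw [hN.apply]; ring

theorem sform_self_eq_ofReal {N : Matrix ι ι ℂ} (hN : N.IsHermitian) (u : ι → ℂ) :
    sform N u u = ((sform N u u).re : ℂ) :=
  (Complex.conj_eq_iff_re.1 (star_sform hN u u)).symm

theorem pairing_outer_combination {N : Matrix ι ι ℂ} (hN : N.IsHermitian) (u v : ι → ℂ)
    (g h : ℂ) : pairing N (outer (g • u + h • v)) =
      Complex.normSq g * pairing N (outer u) + Complex.normSq h * pairing N (outer v) +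
        2 * (star g * h * sform N u v).re := by
  simp only [pairing_outer]
  have hvu := star_sform hN u v
  have h1 : sform N (g • u + h • v) (g • u + h • v) =
      star g * g * sform N u u + star h * h * sform N v v + star g * h * sform N u v +
        star h * g * sform N v u := by
    simp only [sform_eq_dotProduct, star_add, star_smul, Matrix.mulVec_add, Matrix.mulVec_smul,
      add_dotProduct, dotProduct_add, smul_dotProduct, dotProduct_smul, smul_eq_mul]
    ring
  rw [h1, ← hvu, sform_self_eq_ofReal hN u, sform_self_eq_ofReal hN v]
  simp [Complex.normSq_apply]
  ring

/-- The change of the form `N` in the passage from `u u† + v v†` to `x x†` with `x = g u + h v`,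
where `|g|² = 1 + a`, `|h|² = 1 - a` and `conj g * h = ζ`. -/
noncomputable def contrast (N : Matrix ι ι ℂ) (u v : ι → ℂ) (a : ℝ) (ζ : ℂ) : ℝ :=
  a * ((sform N u u).re - (sform N v v).re) + 2 * (ζ * sform N u v).re

theorem pairing_outer_merge {N : Matrix ι ι ℂ} (hN : N.IsHermitian) (u v : ι → ℂ) {g h : ℂ}
    {a : ℝ} (hg : Complex.normSq g = 1 + a) (hh : Complex.normSq h = 1 - a) :
    pairing N (outer (g • u + h • v)) = pairing N (outer u) + pairing N (outer v) +
      contrast N u v a (star g * h) := by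
  rw [pairing_outer_combination hN, hg, hh, contrast]
  simp only [pairing_outer]
  ring

/-- `W` is feasible for the homogeneous constraints `B` and `C`, its `F`-value is at least `v` times
its `A`-value, and its `A`-value is at least `κ`. -/
structure Superoptimal (A B C F : Matrix ι ι ℂ) (v κ : ℝ) (W : Matrix ι ι ℂ) : Prop where
  left : 0 ≤ pairing B W
  right : 0 ≤ pairing C W
  value : v * pairing A W ≤ pairing F W
  size : κ ≤ pairing A W

/-- The companion vector `-conj h u + conj g v`, together with `R`, has the same `B`- and `C`-values
as the given matrix, because those contrasts vanish. It is therefore feasible and bounded by `hopt`.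
Subtracting this bound from twice the lower bound for the given matrix leaves the lower bound for
the merged one. The sign of the `A`-contrast only serves `size`. -/
theorem Superoptimal.merge {A B C F : Matrix ι ι ℂ} {o κ : ℝ} (hA : A.IsHermitian)
    (hB : B.IsHermitian) (hC : C.IsHermitian)
    (hopt : ∀ W : Matrix ι ι ℂ, W.PosSemidef → 0 ≤ pairing B W → 0 ≤ pairing C W →
      pairing F W ≤ o * pairing A W)
    {u v : ι → ℂ} {R : Matrix ι ι ℂ} (hR : R.PosSemidef) {g h : ℂ} {a : ℝ}
    (hg : Complex.normSq g = 1 + a) (hh : Complex.normSq h = 1 - a)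
    (cB : contrast B u v a (star g * h) = 0) (cC : contrast C u v a (star g * h) = 0)
    (cA : 0 ≤ contrast A u v a (star g * h))
    (hW : Superoptimal A B C F o κ (outer u + (outer v + R))) :
    Superoptimal A B C F o κ (outer (g • u + h • v) + R) := by
  have hsum := fun N : Matrix ι ι ℂ => congrArg (pairing N)
    (outer_combination_add (u := u) (v := v) (g := g) (h := h) (by rw [hg, hh]; ring))
  simp only [pairing_smul_right, pairing_add_right] at hsum
  obtain ⟨h1, h2, h3, h4⟩ := hW
  simp only [pairing_add_right] at h1 h2 h3 h4
  have mA := pairing_outer_merge hA u v hg hh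
  have mB := pairing_outer_merge hB u v hg hh
  have mC := pairing_outer_merge hC u v hg hh
  have hopt' := hopt (outer (-star h • u + star g • v) + R) ((outer_posSemidef _).add hR)
  simp only [pairing_add_right] at hopt'
  have h5 := hopt' (by linarith [hsum B]) (by linarith [hsum C])
  have sA := hsum A
  have sF := hsum F
  refine ⟨?_, ?_, ?_, ?_⟩ <;> simp only [pairing_add_right]
  · linarith
  · linarith
  · have : pairing A (outer (-star h • u + star g • v)) = 2 * (pairing A (outer u) +
      pairing A (outer v)) - pairing A (outer (g • u + h • v)) := by linarith
    -- With the companion's `A`-value eliminated, the claim is twice `h3` minus `h5`, rewritten by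
    -- `sF`.
    rw [this] at h5
    nlinarith
  · linarith

/-! ### One step of the Cholesky factorisation -/

variable [DecidableEq ι]

/-- For a positive pivot this is elimination. For a zero pivot, positive semidefiniteness makes the
whole row vanish, and `pivotVec` is `0` because division by `0` gives `0`. -/
theorem pivotVec_row {Y : Matrix ι ι ℂ} (hY : Y.PosSemidef) (k j : ι) :
    (Y - outer (pivotVec Y k)) k j = 0 := by
  obtain ⟨h0, him⟩ := Complex.nonneg_iff.1 (hY.diag_nonneg (i := k))
  have hkk : Y k k = ((Y k k).re : ℂ) := Complex.ext rfl (by simp [← him])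
  simp only [Matrix.sub_apply, outer_apply, pivotVec, star_div₀, hY.1.apply]
  rcases h0.eq_or_lt with h | h
  · have hz : Y *ᵥ Pi.single k 1 = 0 := by
      have hz : Y k k = 0 := by rw [hkk, ← h, Complex.ofReal_zero]
      rw [← hY.dotProduct_mulVec_zero_iff]
      simp [hz]
    have hj : Y j k = 0 := by simpa using congrFun hz j
    have : Y k j = 0 := by rw [← hY.1.apply, hj, star_zero]
    simp [this]
  · have hs : ((Real.sqrt (Y k k).re : ℝ) : ℂ) ≠ 0 := by
      simpa using (Real.sqrt_pos.2 h).ne'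
    have hss : ((Real.sqrt (Y k k).re : ℝ) : ℂ) * ((Real.sqrt (Y k k).re : ℝ) : ℂ) = Y k k := by
      rw [← Complex.ofReal_mul, Real.mul_self_sqrt h0, ← hkk]
    have hst : star ((Real.sqrt (Y k k).re : ℝ) : ℂ) = ((Real.sqrt (Y k k).re : ℝ) : ℂ) :=
      Complex.conj_ofReal _
    rw [hst, div_mul_div_comm, hss, mul_div_right_comm, div_self, one_mul, sub_self]
    rw [← hss]; exact mul_ne_zero hs hs

/-- The remainder is a congruence `S† Y S`, where `S` is the column elimination at the pivot: `Y S`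
is already the remainder, and `S†` fixes it because its row `k` is zero. A zero pivot gives `S = 1`.
-/
theorem sub_outer_pivotVec_posSemidef {Y : Matrix ι ι ℂ} (hY : Y.PosSemidef) (k : ι) :
    (Y - outer (pivotVec Y k)).PosSemidef := by
  set Z := Y - outer (pivotVec Y k) with hZ
  have hZH : Z.IsHermitian := hY.1.sub (outer_posSemidef _).1
  have hrow : ∀ j, Z k j = 0 := pivotVec_row hY k
  obtain ⟨h0, him⟩ := Complex.nonneg_iff.1 (hY.diag_nonneg (i := k))
  have hkk : Y k k = ((Y k k).re : ℂ) := Complex.ext rfl (by simp [← him])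
  let S : Matrix ι ι ℂ := 1 - Matrix.vecMulVec (Pi.single k 1) (fun j => Y k j / Y k k)
  have h1 : Y * S = Z := by
    ext i j
    simp only [S, mul_sub, mul_one, Matrix.mul_vecMulVec, Matrix.mulVec_single_one, Matrix.col_apply,
      Matrix.sub_apply, Matrix.vecMulVec_apply, hZ, outer_apply, pivotVec, star_div₀, hY.1.apply]
    have hst : star ((Real.sqrt (Y k k).re : ℝ) : ℂ) = ((Real.sqrt (Y k k).re : ℝ) : ℂ) :=
      Complex.conj_ofReal _
    rw [hst, div_mul_div_comm, ← Complex.ofReal_mul, Real.mul_self_sqrt h0, ← hkk, mul_div_assoc]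
  have h2 : Sᴴ * Z = Z := by
    ext i j
    simp [S, sub_mul, Matrix.conjTranspose_vecMulVec, Matrix.vecMulVec_mul,
      Matrix.vecMulVec_apply, hrow]
  have h3 := hY.conjTranspose_mul_mul_same S
  rwa [Matrix.mul_assoc, h1, h2] at h3

end Forms

end RelayData

namespace RelayData

/-! ### Elimination of the scalar variables -/

section Reduction

variable {K : ℕ} (D : RelayData K)

noncomputable def signalMat : Var K := D.h1 * D.h1ᴴ

noncomputable def jammerMat : Var K := D.h2 * D.h2ᴴ

noncomputable def harvestMat : Var K :=
  (D.PS : ℂ) • (D.h3 * D.h3ᴴ) + (D.PJ : ℂ) • (D.h4 * D.h4ᴴ) + D.H4 * D.H4ᴴ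

noncomputable def powerMat : Var K :=
  (D.PS : ℂ) • (D.H2 * D.H2ᴴ) + (D.PJ : ℂ) • (D.H3 * D.H3ᴴ) + 1

/-- The normalisation, for the least possible `b²` and `c²`, is `tr(budgetMat X) ≤ 1`. -/
noncomputable def budgetMat : Var K :=
  (D.ρ₀ : ℂ) • D.jammerMat + (D.ρ₁ : ℂ) • (D.H1 * D.H1ᴴ) +
    ((D.ρ₂ / D.PRmax : ℝ) : ℂ) • D.powerMat

/-- The source constraint, for the least possible `c²`, is `0 ≤ tr(marginMat X)`. -/
noncomputable def marginMat : Var K :=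
  D.signalMat - ((D.ρ₀ / D.ε : ℝ) : ℂ) • D.jammerMat

/-- The harvesting constraint, for the least possible `b²`, is `0 ≤ tr(surplusMat X)`. -/
noncomputable def surplusMat : Var K :=
  D.harvestMat - ((D.Q / D.PRmax : ℝ) : ℂ) • D.powerMat

theorem isHermitian_smul {N : Var K} (hN : N.IsHermitian) (r : ℝ) :
    ((r : ℂ) • N).IsHermitian := by
  rw [Matrix.IsHermitian, Matrix.conjTranspose_smul, hN.eq]
  simp

theorem jammerMat_isHermitian : D.jammerMat.IsHermitian :=
  Matrix.isHermitian_mul_conjTranspose_self _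

theorem signalMat_isHermitian : D.signalMat.IsHermitian :=
  Matrix.isHermitian_mul_conjTranspose_self _

theorem powerMat_isHermitian : D.powerMat.IsHermitian :=
  ((isHermitian_smul (Matrix.isHermitian_mul_conjTranspose_self _) _).add
    (isHermitian_smul (Matrix.isHermitian_mul_conjTranspose_self _) _)).add Matrix.isHermitian_one

theorem harvestMat_isHermitian : D.harvestMat.IsHermitian :=
  ((isHermitian_smul (Matrix.isHermitian_mul_conjTranspose_self _) _).add
    (isHermitian_smul (Matrix.isHermitian_mul_conjTranspose_self _) _)).add
    (Matrix.isHermitian_mul_conjTranspose_self _)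

theorem budgetMat_isHermitian : D.budgetMat.IsHermitian :=
  ((isHermitian_smul D.jammerMat_isHermitian _).add
    (isHermitian_smul (Matrix.isHermitian_mul_conjTranspose_self _) _)).add
    (isHermitian_smul D.powerMat_isHermitian _)

theorem marginMat_isHermitian : D.marginMat.IsHermitian :=
  D.signalMat_isHermitian.sub (isHermitian_smul D.jammerMat_isHermitian _)

theorem surplusMat_isHermitian : D.surplusMat.IsHermitian :=
  D.harvestMat_isHermitian.sub (isHermitian_smul D.powerMat_isHermitian _)

/-- The positivity of the parameters. -/
structure Admissible : Prop where
  hPS : 0 < D.PS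
  hPJ : 0 < D.PJ
  hPR : 0 < D.PRmax
  hε : 0 < D.ε

/-! ### Signs of the forms, and equivalence with the reduced constraints -/

variable {D}

theorem pairing_jammerMat_nonneg {X : Var K} (hX : X.PosSemidef) : 0 ≤ pairing D.jammerMat X :=
  pairing_mul_conjTranspose_nonneg _ hX

theorem pairing_signalMat_nonneg {X : Var K} (hX : X.PosSemidef) : 0 ≤ pairing D.signalMat X :=
  pairing_mul_conjTranspose_nonneg _ hX

theorem pairing_harvestMat_nonneg (hD : D.Admissible) {X : Var K} (hX : X.PosSemidef) :
    0 ≤ pairing D.harvestMat X := by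
  simp only [harvestMat, pairing_add_left, pairing_smul_left]
  have h1 := mul_nonneg hD.hPS.le (pairing_mul_conjTranspose_nonneg D.h3 hX)
  have h2 := mul_nonneg hD.hPJ.le (pairing_mul_conjTranspose_nonneg D.h4 hX)
  have h3 := pairing_mul_conjTranspose_nonneg D.H4 hX
  linarith

theorem pairing_one_le_powerMat (hD : D.Admissible) {X : Var K} (hX : X.PosSemidef) :
    pairing 1 X ≤ pairing D.powerMat X := by
  simp only [powerMat, pairing_add_left, pairing_smul_left]
  have h1 := mul_nonneg hD.hPS.le (pairing_mul_conjTranspose_nonneg D.H2 hX)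
  have h2 := mul_nonneg hD.hPJ.le (pairing_mul_conjTranspose_nonneg D.H3 hX)
  linarith

theorem pairing_powerMat_nonneg (hD : D.Admissible) {X : Var K} (hX : X.PosSemidef) :
    0 ≤ pairing D.powerMat X :=
  (pairing_one_nonneg hX).trans (pairing_one_le_powerMat hD hX)

theorem pairing_powerMat_le_budgetMat (hD : D.Admissible) {X : Var K} (hX : X.PosSemidef) :
    D.ρ₂ / D.PRmax * pairing D.powerMat X ≤ pairing D.budgetMat X := by
  simp only [budgetMat, pairing_add_left, pairing_smul_left]
  have h1 : 0 ≤ D.ρ₀ := div_nonneg hD.hPJ.le hD.hPS.le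
  have h2 : 0 ≤ D.ρ₁ := div_nonneg zero_le_one hD.hPS.le
  have h3 := mul_nonneg h1 (pairing_jammerMat_nonneg (D := D) hX)
  have h4 := mul_nonneg h2 (pairing_mul_conjTranspose_nonneg D.H1 hX)
  linarith

theorem ρ₂_div_pos (hD : D.Admissible) : 0 < D.ρ₂ / D.PRmax :=
  div_pos (div_pos one_pos hD.hPS) hD.hPR

theorem pairing_budgetMat_nonneg (hD : D.Admissible) {X : Var K} (hX : X.PosSemidef) :
    0 ≤ pairing D.budgetMat X :=
  (mul_nonneg (ρ₂_div_pos hD).le (pairing_powerMat_nonneg hD hX)).trans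
    (pairing_powerMat_le_budgetMat hD hX)

theorem eq_zero_of_pairing_budgetMat_nonpos (hD : D.Admissible) {X : Var K} (hX : X.PosSemidef)
    (h : pairing D.budgetMat X ≤ 0) : X = 0 := by
  refine eq_zero_of_pairing_one_nonpos hX ((pairing_one_le_powerMat hD hX).trans ?_)
  have := (pairing_powerMat_le_budgetMat hD hX).trans h
  by_contra hc
  exact absurd (mul_pos (ρ₂_div_pos hD) (not_le.1 hc)) (not_lt.2 this)

/-- Replacing `b²` and `c²` by their lower bounds only relaxes the normalisation and the source
constraint, where they enter with a favourable sign. Harvesting needs a distinction by the sign of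
`Q`. -/
theorem RelaxedFeasible.reduced (hD : D.Admissible) {X : Var K} {b c : ℝ}
    (h : D.RelaxedFeasible X b c) :
    pairing D.budgetMat X ≤ 1 ∧ 0 ≤ pairing D.marginMat X ∧ 0 ≤ pairing D.surplusMat X := by
  have hn : D.ρ₀ * c ^ 2 + pairing ((D.ρ₁ : ℂ) • (D.H1 * D.H1ᴴ)) X + D.ρ₂ * b ^ 2 ≤ 1 :=
    h.normalisation
  have hj : pairing D.jammerMat X ≤ c ^ 2 := h.jammer
  have hs : D.ρ₀ * c ^ 2 / D.ε ≤ pairing D.signalMat X := h.source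
  have hh : D.Q * b ^ 2 ≤ pairing D.harvestMat X := h.harvest
  have hp : pairing D.powerMat X ≤ D.PRmax * b ^ 2 := h.power
  have h0 : 0 ≤ D.ρ₀ := div_nonneg hD.hPJ.le hD.hPS.le
  have h2 : 0 ≤ D.ρ₂ := div_nonneg zero_le_one hD.hPS.le
  have hp' : pairing D.powerMat X / D.PRmax ≤ b ^ 2 := by
    rw [div_le_iff₀ hD.hPR]; linarith
  have hp0 : 0 ≤ pairing D.powerMat X / D.PRmax :=
    div_nonneg (pairing_powerMat_nonneg hD h.psd) hD.hPR.le
  rw [pairing_smul_left] at hn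
  simp only [budgetMat, marginMat, surplusMat, pairing_add_left, pairing_sub_left,
    pairing_smul_left]
  refine ⟨?_, ?_, ?_⟩
  · have e1 := mul_le_mul_of_nonneg_left hj h0
    have e2 := mul_le_mul_of_nonneg_left hp' h2
    have e3 : D.ρ₂ / D.PRmax * pairing D.powerMat X =
      D.ρ₂ * (pairing D.powerMat X / D.PRmax) := by ring
    linarith
  · have e1 := mul_le_mul_of_nonneg_left hj (div_nonneg h0 hD.hε.le)
    have e2 : D.ρ₀ / D.ε * c ^ 2 = D.ρ₀ * c ^ 2 / D.ε := by ring
    linarith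
  · have e3 : D.Q / D.PRmax * pairing D.powerMat X =
      D.Q * (pairing D.powerMat X / D.PRmax) := by ring
    rw [e3]
    -- For `Q ≤ 0` the lower bound on `b²` points the wrong way, but the reduced constraint then
    -- holds for every positive semidefinite matrix.
    rcases le_total 0 D.Q with hQ | hQ
    · have := mul_le_mul_of_nonneg_left hp' hQ
      linarith
    · have := mul_nonpos_of_nonpos_of_nonneg hQ hp0
      have := pairing_harvestMat_nonneg hD h.psd
      linarith

/-- With these `b` and `c` the power and jammer constraints are equalities, and the other three
become the reduced ones. -/
theorem relaxedFeasible_of_reduced (hD : D.Admissible) {X : Var K} (hX : X.PosSemidef)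
    (hb : pairing D.budgetMat X ≤ 1) (hm : 0 ≤ pairing D.marginMat X)
    (hs : 0 ≤ pairing D.surplusMat X) :
    D.RelaxedFeasible X (Real.sqrt (pairing D.powerMat X / D.PRmax))
      (Real.sqrt (pairing D.jammerMat X)) := by
  simp only [budgetMat, marginMat, surplusMat, pairing_add_left, pairing_sub_left,
    pairing_smul_left] at hb hm hs
  have hp0 : 0 ≤ pairing D.powerMat X / D.PRmax :=
    div_nonneg (pairing_powerMat_nonneg hD hX) hD.hPR.le
  have e1 := Real.sq_sqrt hp0
  have e2 := Real.sq_sqrt (pairing_jammerMat_nonneg (D := D) hX)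
  refine ⟨hX, ?_, ?_, ?_, ?_, ?_⟩
  · change _ + pairing ((D.ρ₁ : ℂ) • (D.H1 * D.H1ᴴ)) X + _ ≤ _
    rw [e1, e2, pairing_smul_left]
    linarith [show D.ρ₂ / D.PRmax * pairing D.powerMat X =
      D.ρ₂ * (pairing D.powerMat X / D.PRmax) by ring]
  · change pairing D.jammerMat X ≤ _
    rw [e2]
  · change _ ≤ pairing D.signalMat X
    rw [e2]
    linarith [show D.ρ₀ / D.ε * pairing D.jammerMat X =
      D.ρ₀ * pairing D.jammerMat X / D.ε by ring]
  · change _ ≤ pairing D.harvestMat X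
    rw [e1]
    linarith [show D.Q / D.PRmax * pairing D.powerMat X =
      D.Q * (pairing D.powerMat X / D.PRmax) by ring]
  · change pairing D.powerMat X ≤ _
    rw [e1, mul_div_cancel₀ _ hD.hPR.ne']

/-- By homogeneity, the optimum bounds the ratio of objective and budget. -/
theorem RelaxedOptimal.signal_le (hD : D.Admissible) {X : Var K} {b c : ℝ}
    (h : D.RelaxedOptimal X b c) {W : Var K} (hW : W.PosSemidef)
    (hm : 0 ≤ pairing D.marginMat W) (hs : 0 ≤ pairing D.surplusMat W) :
    pairing D.signalMat W ≤ D.objective X * pairing D.budgetMat W := by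
  rcases (pairing_budgetMat_nonneg hD hW).eq_or_lt with h0 | h0
  · rw [eq_zero_of_pairing_budgetMat_nonpos hD hW h0.ge]
    simp [pairing_zero_right]
  · set r := (pairing D.budgetMat W)⁻¹ with hr
    have hr0 : 0 < r := inv_pos.2 h0
    have hf := relaxedFeasible_of_reduced hD (X := (r : ℂ) • W)
      (hW.smul (by exact_mod_cast hr0.le))
      (by rw [pairing_smul_right, hr, inv_mul_cancel₀ h0.ne'])
      (by rw [pairing_smul_right]; exact mul_nonneg hr0.le hm)
      (by rw [pairing_smul_right]; exact mul_nonneg hr0.le hs)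
    have h1 : pairing D.signalMat ((r : ℂ) • W) ≤ D.objective X := h.2 _ _ _ hf
    rwa [pairing_smul_right, hr, inv_mul_le_iff₀ h0, mul_comm] at h1

/-- A vector from which a solution of rank at most one can be read off. -/
structure Solves (D : RelayData K) (X : Var K) (u : Fin K × Fin K → ℂ) : Prop where
  margin : 0 ≤ pairing D.marginMat (outer u)
  surplus : 0 ≤ pairing D.surplusMat (outer u)
  value : D.objective X * pairing D.budgetMat (outer u) ≤ pairing D.signalMat (outer u)
  eq_zero : u = 0 → X = 0 ∧ ¬ (2 ≤ K ∧ D.Q ≤ 0)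

/-- The matrix `u u†` is scaled to budget one; for `u = 0` the inverse is `0` and so is `Xs`. If `Xs
= 0`, then `u = 0`, hence `X = 0` and the assumption on `K` and `Q` leaves only `Q > 0`; harvesting
at `X = 0` then reads `Q b² ≤ 0`, against `b ≠ 0`. -/
theorem Solves.optimal (hD : D.Admissible) {X : Var K} {b c : ℝ}
    (h : D.RelaxedOptimal X b c) {u : Fin K × Fin K → ℂ} (hu : D.Solves X u) {Xs : Var K}
    (hXs : Xs = (((pairing D.budgetMat (outer u))⁻¹ : ℝ) : ℂ) • outer u) {bs cs : ℝ}
    (hbs : bs = Real.sqrt (pairing D.powerMat Xs / D.PRmax))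
    (hcs : cs = Real.sqrt (pairing D.jammerMat Xs)) :
    D.RelaxedOptimal Xs bs cs ∧ D.RankOptimal Xs bs cs ∧ D.objective Xs = D.objective X ∧
      Xs.rank ≤ 1 ∧ (b ≠ 0 → (2 ≤ K ∨ 0 < D.Q) → Xs.rank = 1) := by
  have hA0 := pairing_budgetMat_nonneg hD (outer_posSemidef u)
  set α := pairing D.budgetMat (outer u) with hα
  have hr0 : 0 ≤ α⁻¹ := inv_nonneg.2 hA0
  have hαz : α = 0 → u = 0 := fun hz => outer_eq_zero.1
    (eq_zero_of_pairing_budgetMat_nonpos hD (outer_posSemidef u) (by rw [← hα, hz]))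
  have hpsd : Xs.PosSemidef := by
    rw [hXs]; exact (outer_posSemidef u).smul (by exact_mod_cast hr0)
  have hpair : ∀ N, pairing N Xs = α⁻¹ * pairing N (outer u) := fun N => by
    rw [hXs, pairing_smul_right]
  have hfeas : D.RelaxedFeasible Xs bs cs := by
    rw [hbs, hcs]
    refine relaxedFeasible_of_reduced hD hpsd ?_ ?_ ?_ <;> rw [hpair]
    -- This is an equality unless the budget is `0`, when the product is `0`.
    · exact inv_mul_le_one
    · exact mul_nonneg hr0 hu.margin
    · exact mul_nonneg hr0 hu.surplus
  have hle : D.objective X ≤ D.objective Xs := by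
    change _ ≤ pairing D.signalMat Xs
    rw [hpair]
    rcases hA0.eq_or_lt with h0 | h0
    · rw [(hu.eq_zero (hαz h0.symm)).1, ← h0]
      simp [objective]
    · rw [le_inv_mul_iff₀ h0, mul_comm]
      exact hu.value
  have hrank : Xs.rank ≤ 1 := by
    rw [hXs, outer, ← Matrix.smul_vecMulVec]
    exact Matrix.rank_vecMulVec_le _ _
  refine ⟨⟨hfeas, fun X' b' c' h' => (h.2 X' b' c' h').trans hle⟩,
    ⟨⟨hfeas, hrank⟩, fun X' b' c' h' => (h.2 X' b' c' h'.1).trans hle⟩,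
    le_antisymm (h.2 _ _ _ hfeas) hle, hrank, fun hb hKQ => ?_⟩
  refine le_antisymm hrank (Nat.one_le_iff_ne_zero.2 fun hz => ?_)
  have hXs0 : Xs = 0 := by
    have h1 := LinearMap.range_eq_bot.1 (Submodule.finrank_eq_zero.1 hz)
    refine Matrix.mulVec_injective (funext fun x => ?_)
    simpa using LinearMap.congr_fun h1 x
  have hu0 : u = 0 := by
    by_contra hne
    have hα0 : α ≠ 0 := fun hc => hne (hαz hc)
    rw [hXs, smul_eq_zero, outer_eq_zero] at hXs0
    rcases hXs0 with h1 | h1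
    · exact hα0 (by simpa using h1)
    · exact hne h1
  obtain ⟨hX0, hnot⟩ := hu.eq_zero hu0
  have hQ : 0 < D.Q := by
    rcases hKQ with h1 | h1
    · by_contra hc
      exact hnot ⟨h1, not_lt.1 hc⟩
    · exact h1
  have hh := h.1.harvest
  rw [hX0, mul_zero, Matrix.trace_zero, Complex.zero_re] at hh
  exact absurd (mul_pos hQ (by positivity : 0 < b ^ 2)) (not_lt.2 hh)

/-- If the given solution is `0` and the harvesting threshold is not positive, then any vector
orthogonal to `h₁` and `h₂` will do. -/
theorem solves_of_orthogonal (hD : D.Admissible) (hQ : D.Q ≤ 0) {u : Fin K × Fin K → ℂ}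
    (hu : u ≠ 0) (h1 : pairing D.signalMat (outer u) = 0)
    (h2 : pairing D.jammerMat (outer u) = 0) : D.Solves 0 u where
  margin := by rw [marginMat, pairing_sub_left, pairing_smul_left, h1, h2, mul_zero, sub_zero]
  surplus := by
    simp only [surplusMat, pairing_sub_left, pairing_smul_left]
    have e1 := pairing_harvestMat_nonneg hD (outer_posSemidef u)
    have e2 := mul_nonneg (div_nonneg (neg_nonneg.2 hQ) hD.hPR.le)
      (pairing_powerMat_nonneg hD (outer_posSemidef u))
    have e3 : -D.Q / D.PRmax * pairing D.powerMat (outer u) =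
      -(D.Q / D.PRmax * pairing D.powerMat (outer u)) := by ring
    linarith
  value := by simp [objective, h1]
  eq_zero h := absurd h hu

/-- The bound `size` is what makes `u = 0` imply `X = 0`: the budget form is definite. -/
theorem Superoptimal.solves (hD : D.Admissible) {X : Var K} {b c : ℝ}
    (h : D.RelaxedOptimal X b c) {u : Fin K × Fin K → ℂ}
    (hu : Superoptimal D.budgetMat D.marginMat D.surplusMat D.signalMat (D.objective X)
      (pairing D.budgetMat X) (outer u)) (hne : u = 0 → ¬ (2 ≤ K ∧ D.Q ≤ 0)) :
    D.Solves X u where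
  margin := hu.left
  surplus := hu.right
  value := hu.value
  eq_zero h0 := by
    refine ⟨eq_zero_of_pairing_budgetMat_nonpos hD h.1.psd ?_, hne h0⟩
    have := hu.size
    rwa [h0, outer_eq_zero.2 rfl, pairing_zero_right] at this

theorem RelaxedOptimal.superoptimal (hD : D.Admissible) {X : Var K} {b c : ℝ}
    (h : D.RelaxedOptimal X b c) :
    Superoptimal D.budgetMat D.marginMat D.surplusMat D.signalMat (D.objective X)
      (pairing D.budgetMat X) X := by
  obtain ⟨h1, h2, h3⟩ := h.1.reduced hD
  refine ⟨h2, h3, ?_, le_rfl⟩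
  -- As the optimum is nonnegative and the budget at most `1`, the objective `o` is at least `o`
  -- times the budget.
  have h4 : 0 ≤ D.objective X := pairing_signalMat_nonneg h.1.psd
  exact mul_le_of_le_one_right h4 h1

end Reduction

end RelayData

namespace RAM

/-! ### Vectors and matrices in memory -/

section Holds

variable {K : ℕ}

/-- The position of an index pair in the linear order. -/
def idx (p : Fin K × Fin K) : ℕ := (finProdFinEquiv p : Fin (K * K))

theorem idx_eq (p : Fin K × Fin K) : idx p = K * p.1 + p.2 := by
  simp [idx, finProdFinEquiv, add_comm]

theorem idx_lt (p : Fin K × Fin K) : idx p < K * K := (finProdFinEquiv p).2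

theorem idx_injective : Function.Injective (idx : Fin K × Fin K → ℕ) := fun _ _ h =>
  finProdFinEquiv.injective (Fin.ext h)

theorem exists_idx_eq {k : ℕ} (hk : k < K * K) : ∃ p : Fin K × Fin K, idx p = k :=
  ⟨finProdFinEquiv.symm ⟨k, hk⟩, by rw [idx, Equiv.apply_symm_apply]⟩

theorem sum_range_idx (f : ℕ → ℂ) :
    ∑ i ∈ Finset.range (K * K), f i = ∑ p : Fin K × Fin K, f (idx p) := by
  rw [Finset.sum_range]
  exact (Equiv.sum_comp finProdFinEquiv (fun i : Fin (K * K) => f i)).symm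

/-- The array `m` holds the vector `u` in its column `0`. -/
def HoldsVec (m : ℕ → ℕ → ℂ) (u : Fin K × Fin K → ℂ) : Prop := ∀ p, m (idx p) 0 = u p

/-- The array `m` holds the matrix `Y`. -/
def HoldsMat (m : ℕ → ℕ → ℂ) (Y : RelayData.Var K) : Prop := ∀ p q, m (idx p) (idx q) = Y p q

theorem formProg_eq_sform {x y N u v t : ℕ} {σ : State} (hσ : σ.reg 1 = K * K) (hxy : x ≠ y)
    (hx1 : x ≠ 1) (hy1 : y ≠ 1) (hN : N ≠ t) (hu : u ≠ t) (hv : v ≠ t)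
    {M : RelayData.Var K} {U V : Fin K × Fin K → ℂ} (hM : HoldsMat (σ.mem N) M)
    (hU : HoldsVec (σ.mem u) U) (hV : HoldsVec (σ.mem v) V) :
    ((formProg x y N u v t).exec σ).mem t 0 0 = RelayData.sform M U V := by
  rw [formProg_mem hxy hx1 hy1 hN hu hv, hσ, sum_range_idx]
  refine Finset.sum_congr rfl fun p _ => ?_
  rw [sum_range_idx]
  exact Finset.sum_congr rfl fun q _ => by rw [hU, hM, hV]

end Holds

/-! ### Scalar computations -/

/-- The scalar in position `(0, 0)` of an array. -/
abbrev cell (t : ℕ) : Expr := .get t (.const 0) (.const 0)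

abbrev setCell (t : ℕ) (e : Expr) : Prog := .store t (.const 0) (.const 0) e

abbrev setCells (t : ℕ) (e₁ e₂ e₃ : Expr) : Prog :=
  .seq (setCell t e₁) (.seq (setCell (t + 1) e₂) (setCell (t + 2) e₃))

/-- The real part of a scalar. -/
def Expr.rePart (e : Expr) : Expr := .div (.add e (.conj e)) (.const 2)

theorem eval_rePart (σ : State) (e : Expr) : e.rePart.eval σ = ((e.eval σ).re : ℂ) := by
  have h := Complex.add_conj (e.eval σ)
  simp only [Expr.rePart, Expr.eval]
  rw [show star (e.eval σ) = (starRingEnd ℂ) (e.eval σ) from rfl, h]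
  push_cast
  ring

/-- Three consecutive cells hold a vector of `ℝ³`. -/
def HoldsTriple (σ : State) (t : ℕ) (x y z : ℝ) : Prop :=
  σ.mem t 0 0 = (x : ℂ) ∧ σ.mem (t + 1) 0 0 = (y : ℂ) ∧ σ.mem (t + 2) 0 0 = (z : ℂ)

/-- The inner product of the vectors in the cells from `s` and from `t`. -/
def dotExpr (s t : ℕ) : Expr :=
  .add (.add (.mul (cell s) (cell t)) (.mul (cell (s + 1)) (cell (t + 1))))
    (.mul (cell (s + 2)) (cell (t + 2)))

theorem eval_dotExpr {σ : State} {s t : ℕ} {x y z x' y' z' : ℝ} (h : HoldsTriple σ s x y z)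
    (h' : HoldsTriple σ t x' y' z') :
    (dotExpr s t).eval σ = ((x * x' + y * y' + z * z' : ℝ) : ℂ) := by
  simp [dotExpr, Expr.eval, IdxExpr.eval, h.1, h.2.1, h.2.2, h'.1, h'.2.1, h'.2.2]

theorem holdsTriple_setCells {σ : State} {t : ℕ} {e₁ e₂ e₃ : Expr} {x y z : ℝ}
    (h₁ : e₁.eval σ = (x : ℂ))
    (h₂ : ∀ τ : State, (∀ a, a ≠ t → τ.mem a = σ.mem a) → e₂.eval τ = (y : ℂ))
    (h₃ : ∀ τ : State, (∀ a, a ≠ t → a ≠ t + 1 → τ.mem a = σ.mem a) → e₃.eval τ = (z : ℂ)) :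
    HoldsTriple ((setCells t e₁ e₂ e₃).exec σ) t x y z := by
  simp only [setCells, exec_seq, exec_store]
  rw [h₁, h₂ _ fun a ha => by funext i j; simp [store_mem, ha],
    h₃ _ fun a ha hb => by funext i j; simp [store_mem, ha, hb]]
  simp [HoldsTriple, store_mem, IdxExpr.eval]

theorem HoldsTriple.of_mem_eq {σ τ : State} {t : ℕ} {x y z : ℝ} (h : HoldsTriple σ t x y z)
    (h₀ : τ.mem t = σ.mem t) (h₁ : τ.mem (t + 1) = σ.mem (t + 1))
    (h₂ : τ.mem (t + 2) = σ.mem (t + 2)) : HoldsTriple τ t x y z := by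
  simpa [HoldsTriple, h₀, h₁, h₂] using h

/-- The coefficients of the contrast of a form, from its values in the cells `s`, `s + 1`,
`s + 2`. -/
def contrastProg (s t : ℕ) : Prog :=
  setCells t (Expr.rePart (.sub (cell s) (cell (s + 1))))
    (Expr.rePart (.mul (.const 2) (cell (s + 2))))
    (Expr.rePart (.mul (.mul (.const 2) .imagUnit) (cell (s + 2))))

theorem contrastProg_holds {σ : State} {s t : ℕ} (h : s + 2 < t) {x y z : ℂ}
    (hx : σ.mem s 0 0 = x) (hy : σ.mem (s + 1) 0 0 = y) (hz : σ.mem (s + 2) 0 0 = z) :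
    HoldsTriple ((contrastProg s t).exec σ) t (x.re - y.re) (2 * z.re) (-2 * z.im) := by
  refine holdsTriple_setCells ?_ (fun τ hτ => ?_) fun τ hτ => ?_ <;> rw [eval_rePart]
  · simp [Expr.eval, IdxExpr.eval, hx, hy]
  · simp [Expr.eval, IdxExpr.eval, hτ (s + 2) (by omega), hz]
  · simp [Expr.eval, IdxExpr.eval, hτ (s + 2) (by omega) (by omega), hz]

/-- A unit vector in the cells from `30`, orthogonal to those in the cells from `40` and `43`, and
with a nonnegative inner product with the one in the cells from `46`. -/
def directionProg : Prog :=
  .seq (setCells 30 (.sub (.mul (cell 41) (cell 45)) (.mul (cell 42) (cell 44)))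
      (.sub (.mul (cell 42) (cell 43)) (.mul (cell 40) (cell 45)))
      (.sub (.mul (cell 40) (cell 44)) (.mul (cell 41) (cell 43)))) <|
  .seq (.ite (.reLe (dotExpr 30 30) (.const 0))
      (.seq (.ite (.reLe (dotExpr 40 40) (.const 0))
        (setCells 30 (.const 0) (cell 45) (.sub (.const 0) (cell 44)))
        (setCells 30 (.const 0) (cell 42) (.sub (.const 0) (cell 41))))
        (.ite (.reLe (dotExpr 30 30) (.const 0))
          (setCells 30 (.const 0) (.const 1) (.const 0)) .skip)) .skip) <|
  .seq (.ite (.reLe (dotExpr 30 46) (.const 0))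
    (setCells 30 (.sub (.const 0) (cell 30)) (.sub (.const 0) (cell 31))
      (.sub (.const 0) (cell 32))) .skip) <|
  .seq (setCell 33 (.sqrt (dotExpr 30 30)))
    (setCells 30 (.div (cell 30) (cell 33)) (.div (cell 31) (cell 33)) (.div (cell 32) (cell 33)))

theorem sq_sum_nonpos {x y z : ℝ} (h : x * x + y * y + z * z ≤ 0) : x = 0 ∧ y = 0 ∧ z = 0 := by
  refine ⟨?_, ?_, ?_⟩ <;> nlinarith [mul_self_nonneg x, mul_self_nonneg y, mul_self_nonneg z]

/-- The cross product of `p` and `q` works unless they are dependent. In that case a vector in the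
plane of the last two coordinates, perpendicular to a nonzero one of them, is perpendicular to both.
Changing the sign settles the third condition. -/
theorem directionProg_holds {σ : State} {p₁ p₂ p₃ q₁ q₂ q₃ r₁ r₂ r₃ : ℝ}
    (hp : HoldsTriple σ 40 p₁ p₂ p₃) (hq : HoldsTriple σ 43 q₁ q₂ q₃)
    (hr : HoldsTriple σ 46 r₁ r₂ r₃) :
    ∃ w₁ w₂ w₃ : ℝ, HoldsTriple (directionProg.exec σ) 30 w₁ w₂ w₃ ∧
      w₁ * p₁ + w₂ * p₂ + w₃ * p₃ = 0 ∧ w₁ * q₁ + w₂ * q₂ + w₃ * q₃ = 0 ∧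
      0 ≤ w₁ * r₁ + w₂ * r₂ + w₃ * r₃ ∧ w₁ * w₁ + w₂ * w₂ + w₃ * w₃ = 1 := by
  have keep : ∀ {t : ℕ} {x y z : ℝ} (P : Prog) (τ : State), P.arrs ⊆ [30, 31, 32, 33] → 40 ≤ t →
      HoldsTriple τ t x y z → HoldsTriple (P.exec τ) t x y z := by
    intro t x y z P τ hP ht h
    have : ∀ a, 40 ≤ a → (P.exec τ).mem a = τ.mem a := fun a ha =>
      exec_mem_of_notMem (fun hmem => by have := hP hmem; simp at this; omega) τ
    exact h.of_mem_eq (this _ ht) (this _ (by omega)) (this _ (by omega))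
  rw [directionProg, exec_seq, exec_seq, exec_seq, exec_seq]
  -- the cross product
  set P₁ := setCells 30 (.sub (.mul (cell 41) (cell 45)) (.mul (cell 42) (cell 44)))
      (.sub (.mul (cell 42) (cell 43)) (.mul (cell 40) (cell 45)))
      (.sub (.mul (cell 40) (cell 44)) (.mul (cell 41) (cell 43))) with hP₁
  have h₁ : HoldsTriple (P₁.exec σ) 30 (p₂ * q₃ - p₃ * q₂) (p₃ * q₁ - p₁ * q₃)
      (p₁ * q₂ - p₂ * q₁) := by
    obtain ⟨a1, a2, a3⟩ := hp
    obtain ⟨b1, b2, b3⟩ := hq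
    norm_num at a2 a3 b2 b3
    refine holdsTriple_setCells ?_ (fun τ hτ => ?_) fun τ hτ => ?_
    · simp [Expr.eval, IdxExpr.eval, a2, b3, a3, b2]
    · simp [Expr.eval, IdxExpr.eval, hτ, a1, b3, a3, b1]
    · simp [Expr.eval, IdxExpr.eval, hτ, a1, b2, a2, b1]
  have hp₁ := keep P₁ σ (by decide) (by decide) hp
  have hq₁ := keep P₁ σ (by decide) (by decide) hq
  have hr₁ := keep P₁ σ (by decide) (by decide) hr
  generalize P₁.exec σ = σ₁ at h₁ hp₁ hq₁ hr₁ ⊢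
  -- a nonzero orthogonal vector
  set P₂ := Prog.ite (.reLe (dotExpr 30 30) (.const 0))
      (.seq (.ite (.reLe (dotExpr 40 40) (.const 0))
        (setCells 30 (.const 0) (cell 45) (.sub (.const 0) (cell 44)))
        (setCells 30 (.const 0) (cell 42) (.sub (.const 0) (cell 41))))
        (.ite (.reLe (dotExpr 30 30) (.const 0))
          (setCells 30 (.const 0) (.const 1) (.const 0)) .skip)) .skip with hP₂
  have h₂ : ∃ w₁ w₂ w₃ : ℝ, HoldsTriple (P₂.exec σ₁) 30 w₁ w₂ w₃ ∧
      w₁ * p₁ + w₂ * p₂ + w₃ * p₃ = 0 ∧ w₁ * q₁ + w₂ * q₂ + w₃ * q₃ = 0 ∧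
      0 < w₁ * w₁ + w₂ * w₂ + w₃ * w₃ := by
    by_cases c₁ : (Cond.reLe (dotExpr 30 30) (.const 0)).Holds σ₁
    swap
    · refine ⟨_, _, _, by rw [hP₂, exec_ite_neg c₁]; exact h₁, by ring, by ring, ?_⟩
      simpa only [Cond.Holds, eval_dotExpr h₁ h₁, Expr.eval, Complex.ofReal_re, Rat.cast_zero,
        Complex.zero_re, not_le] using c₁
    rw [hP₂, exec_ite_pos c₁, exec_seq]
    simp only [Cond.Holds, eval_dotExpr h₁ h₁, Expr.eval, Complex.ofReal_re, Rat.cast_zero,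
      Complex.zero_re] at c₁
    obtain ⟨e₁, e₂, e₃⟩ := sq_sum_nonpos c₁
    set P₃ := Prog.ite (.reLe (dotExpr 40 40) (.const 0))
        (setCells 30 (.const 0) (cell 45) (.sub (.const 0) (cell 44)))
        (setCells 30 (.const 0) (cell 42) (.sub (.const 0) (cell 41))) with hP₃
    -- The last clause covers the failure of this choice: then `p` and `q` have second coordinate
    -- `0`, and `(0, 1, 0)` is orthogonal to both.
    have h₃ : ∃ w₂ w₃ : ℝ, HoldsTriple (P₃.exec σ₁) 30 0 w₂ w₃ ∧
      w₂ * p₂ + w₃ * p₃ = 0 ∧ w₂ * q₂ + w₃ * q₃ = 0 ∧ (w₂ = 0 → w₃ = 0 → p₂ = 0 ∧ q₂ = 0) := by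
      obtain ⟨a1, a2, a3⟩ := id hp₁
      obtain ⟨b1, b2, b3⟩ := id hq₁
      norm_num at a2 a3 b2 b3
      by_cases c₂ : (Cond.reLe (dotExpr 40 40) (.const 0)).Holds σ₁
      · rw [hP₃, exec_ite_pos c₂]
        simp only [Cond.Holds, eval_dotExpr hp₁ hp₁, Expr.eval, Complex.ofReal_re, Rat.cast_zero,
          Complex.zero_re] at c₂
        obtain ⟨rfl, rfl, rfl⟩ := sq_sum_nonpos c₂
        refine ⟨q₃, -q₂, holdsTriple_setCells ?_ (fun τ hτ => ?_) fun τ hτ => ?_, by ring, by ring,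
          fun _ h => ⟨rfl, neg_eq_zero.1 h⟩⟩
        · simp [Expr.eval]
        · simp [Expr.eval, IdxExpr.eval, hτ, b3]
        · simp [Expr.eval, IdxExpr.eval, hτ, b2]
      · rw [hP₃, exec_ite_neg c₂]
        simp only [Cond.Holds, eval_dotExpr hp₁ hp₁, Expr.eval, Complex.ofReal_re, Rat.cast_zero,
          Complex.zero_re, not_le] at c₂
        refine ⟨p₃, -p₂, holdsTriple_setCells ?_ (fun τ hτ => ?_) fun τ hτ => ?_, by ring,
          by linarith, fun h3 h => ?_⟩
        · simp [Expr.eval]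
        · simp [Expr.eval, IdxExpr.eval, hτ, a3]
        · simp [Expr.eval, IdxExpr.eval, hτ, a2]
        · have h2 : p₂ = 0 := neg_eq_zero.1 h
          subst h2 h3
          refine ⟨rfl, ?_⟩
          have hp0 : p₁ ≠ 0 := by rintro rfl; simp at c₂
          have : p₁ * q₂ = 0 := by linarith
          exact (mul_eq_zero.1 this).resolve_left hp0
    obtain ⟨w₂, w₃, h₃, o₁, o₂, o₃⟩ := h₃
    generalize P₃.exec σ₁ = σ₂ at h₃ ⊢
    by_cases c₃ : (Cond.reLe (dotExpr 30 30) (.const 0)).Holds σ₂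
    · rw [exec_ite_pos c₃]
      simp only [Cond.Holds, eval_dotExpr h₃ h₃, Expr.eval, Complex.ofReal_re, Rat.cast_zero,
        Complex.zero_re] at c₃
      obtain ⟨-, z₂, z₃⟩ := sq_sum_nonpos c₃
      obtain ⟨y₁, y₂⟩ := o₃ z₂ z₃
      refine ⟨0, 1, 0, holdsTriple_setCells ?_ (fun τ hτ => ?_) fun τ hτ => ?_, ?_, ?_, by norm_num⟩
      · simp [Expr.eval]
      · simp [Expr.eval]
      · simp [Expr.eval]
      · simp [y₁]
      · simp [y₂]
    · rw [exec_ite_neg c₃]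
      refine ⟨0, w₂, w₃, h₃, by linarith, by linarith, ?_⟩
      simpa only [Cond.Holds, eval_dotExpr h₃ h₃, Expr.eval, Complex.ofReal_re, Rat.cast_zero,
        Complex.zero_re, not_le] using c₃
  have hr₂ := keep P₂ σ₁ (by decide) (by decide) hr₁
  generalize P₂.exec σ₁ = σ₂ at h₂ hr₂ ⊢
  obtain ⟨w₁, w₂, w₃, h₂, o₁, o₂, o₃⟩ := h₂
  -- the sign
  set P₄ := Prog.ite (.reLe (dotExpr 30 46) (.const 0))
    (setCells 30 (.sub (.const 0) (cell 30)) (.sub (.const 0) (cell 31))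
      (.sub (.const 0) (cell 32))) .skip with hP₄
  have h₄ : ∃ w₁ w₂ w₃ : ℝ, HoldsTriple (P₄.exec σ₂) 30 w₁ w₂ w₃ ∧
      w₁ * p₁ + w₂ * p₂ + w₃ * p₃ = 0 ∧ w₁ * q₁ + w₂ * q₂ + w₃ * q₃ = 0 ∧
      0 ≤ w₁ * r₁ + w₂ * r₂ + w₃ * r₃ ∧ 0 < w₁ * w₁ + w₂ * w₂ + w₃ * w₃ := by
    by_cases c₁ : (Cond.reLe (dotExpr 30 46) (.const 0)).Holds σ₂
    · rw [hP₄, exec_ite_pos c₁]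
      simp only [Cond.Holds, eval_dotExpr h₂ hr₂, Expr.eval, Complex.ofReal_re, Rat.cast_zero,
        Complex.zero_re] at c₁
      obtain ⟨a1, a2, a3⟩ := id h₂
      norm_num at a2 a3
      refine ⟨-w₁, -w₂, -w₃, holdsTriple_setCells ?_ (fun τ hτ => ?_) fun τ hτ => ?_, by linarith,
        by linarith, by linarith, by linarith⟩
      · simp [Expr.eval, IdxExpr.eval, a1]
      · simp [Expr.eval, IdxExpr.eval, hτ, a2]
      · simp [Expr.eval, IdxExpr.eval, hτ, a3]
    · rw [hP₄, exec_ite_neg c₁]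
      simp only [Cond.Holds, eval_dotExpr h₂ hr₂, Expr.eval, Complex.ofReal_re, Rat.cast_zero,
        Complex.zero_re, not_le] at c₁
      exact ⟨w₁, w₂, w₃, h₂, o₁, o₂, c₁.le, o₃⟩
  generalize P₄.exec σ₂ = σ₃ at h₄ ⊢
  clear h₂ o₁ o₂ o₃
  obtain ⟨w₁, w₂, w₃, h₂, o₁, o₂, o₄, o₃⟩ := h₄
  -- normalisation
  set s := Real.sqrt (w₁ * w₁ + w₂ * w₂ + w₃ * w₃) with hs
  have hs0 : 0 < s := Real.sqrt_pos.2 o₃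
  have hss : s * s = w₁ * w₁ + w₂ * w₂ + w₃ * w₃ := Real.mul_self_sqrt o₃.le
  have h33 : ((setCell 33 (.sqrt (dotExpr 30 30))).exec σ₃).mem 33 0 0 = (s : ℂ) := by
    simp only [exec_store, store_mem, IdxExpr.eval, and_self, if_true, Expr.eval,
      eval_dotExpr h₂ h₂, Complex.ofReal_re, hs]
  have h₅ : HoldsTriple ((setCell 33 (.sqrt (dotExpr 30 30))).exec σ₃) 30 w₁ w₂ w₃ :=
    h₂.of_mem_eq (exec_mem_of_notMem (by decide) _) (exec_mem_of_notMem (by decide) _)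
      (exec_mem_of_notMem (by decide) _)
  generalize (setCell 33 (.sqrt (dotExpr 30 30))).exec σ₃ = σ₄ at h33 h₅ ⊢
  obtain ⟨a1, a2, a3⟩ := h₅
  norm_num at a2 a3
  refine ⟨w₁ / s, w₂ / s, w₃ / s, holdsTriple_setCells ?_ (fun τ hτ => ?_) fun τ hτ => ?_, ?_, ?_,
    ?_, ?_⟩
  · simp [Expr.eval, IdxExpr.eval, a1, h33]
  · simp [Expr.eval, IdxExpr.eval, hτ, a2, h33]
  · simp [Expr.eval, IdxExpr.eval, hτ, a3, h33]
  · rw [show w₁ / s * p₁ + w₂ / s * p₂ + w₃ / s * p₃ = (w₁ * p₁ + w₂ * p₂ + w₃ * p₃) / s by ring,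
      o₁, zero_div]
  · rw [show w₁ / s * q₁ + w₂ / s * q₂ + w₃ / s * q₃ = (w₁ * q₁ + w₂ * q₂ + w₃ * q₃) / s by ring,
      o₂, zero_div]
  · rw [show w₁ / s * r₁ + w₂ / s * r₂ + w₃ / s * r₃ = (w₁ * r₁ + w₂ * r₂ + w₃ * r₃) / s by ring]
    exact div_nonneg o₄ hs0.le
  · rw [show w₁ / s * (w₁ / s) + w₂ / s * (w₂ / s) + w₃ / s * (w₃ / s) =
      (w₁ * w₁ + w₂ * w₂ + w₃ * w₃) / (s * s) by ring, hss, div_self o₃.ne']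

/-- The coefficients for merging two vectors, in the cells `34` and `35`, from the direction in the
cells from `30`. -/
def coefficientProg : Prog :=
  .ite (.reLe (.add (.const 1) (cell 30)) (.const 0))
    (.seq (setCell 34 (.const 0)) (setCell 35 (.sqrt (.const 2))))
    (.seq (setCell 34 (.sqrt (.add (.const 1) (cell 30))))
      (setCell 35 (.div (.add (cell 31) (.mul .imagUnit (cell 32))) (cell 34))))

/-- With `g = √(1 + w₁)` real and `h = (w₂ + i w₃) / g`, the unit length gives `|h|² = (1 - w₁²) /
(1 + w₁) = 1 - w₁`. The pole `w₁ = -1`, where `g` vanishes, is treated separately with `h = √2`. -/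
theorem coefficientProg_holds {σ : State} {w₁ w₂ w₃ : ℝ} (h : HoldsTriple σ 30 w₁ w₂ w₃)
    (hw : w₁ * w₁ + w₂ * w₂ + w₃ * w₃ = 1) :
    ∃ g₁ g₂ : ℂ, (coefficientProg.exec σ).mem 34 0 0 = g₁ ∧
      (coefficientProg.exec σ).mem 35 0 0 = g₂ ∧ Complex.normSq g₁ = 1 + w₁ ∧
      Complex.normSq g₂ = 1 - w₁ ∧ star g₁ * g₂ = w₂ + Complex.I * w₃ := by
  refine ⟨_, _, rfl, rfl, ?_⟩
  obtain ⟨a1, a2, a3⟩ := h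
  norm_num at a2 a3
  by_cases c : (Cond.reLe (.add (.const 1) (cell 30)) (.const 0)).Holds σ
  · rw [coefficientProg, exec_ite_pos c]
    simp only [Cond.Holds, Expr.eval, IdxExpr.eval, a1, Rat.cast_one, Rat.cast_zero,
      Complex.add_re, Complex.one_re, Complex.ofReal_re, Complex.zero_re] at c
    have h1 : w₁ = -1 := by nlinarith [mul_self_nonneg w₂, mul_self_nonneg w₃]
    obtain ⟨-, h2, h3⟩ := sq_sum_nonpos (x := 0) (y := w₂) (z := w₃) (by rw [h1] at hw; linarith)
    have e34 : ((Prog.seq (setCell 34 (.const 0)) (setCell 35 (.sqrt (.const 2)))).exec σ).mem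
        34 0 0 = 0 := by simp [exec_seq, exec_store, store_mem, Expr.eval, IdxExpr.eval]
    have e35 : ((Prog.seq (setCell 34 (.const 0)) (setCell 35 (.sqrt (.const 2)))).exec σ).mem
        35 0 0 = (Real.sqrt 2 : ℝ) := by
      simp [exec_seq, exec_store, store_mem, Expr.eval, IdxExpr.eval]
    rw [e34, e35, h1, h2, h3]
    norm_num [Complex.normSq_ofReal]
  · rw [coefficientProg, exec_ite_neg c]
    simp only [Cond.Holds, Expr.eval, IdxExpr.eval, a1, Rat.cast_one, Rat.cast_zero,
      Complex.add_re, Complex.one_re, Complex.ofReal_re, Complex.zero_re, not_le] at c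
    set s := Real.sqrt (1 + w₁) with hs
    have hs0 : 0 < s := Real.sqrt_pos.2 c
    have hss : s * s = 1 + w₁ := Real.mul_self_sqrt c.le
    have hsC : (s : ℂ) ≠ 0 := by exact_mod_cast hs0.ne'
    set P := Prog.seq (setCell 34 (.sqrt (.add (.const 1) (cell 30))))
      (setCell 35 (.div (.add (cell 31) (.mul .imagUnit (cell 32))) (cell 34))) with hP
    have e34 : (P.exec σ).mem 34 0 0 = (s : ℂ) := by
      simp [hP, exec_seq, exec_store, store_mem, Expr.eval, IdxExpr.eval, a1, hs]
    have e35 : (P.exec σ).mem 35 0 0 = (w₂ + Complex.I * w₃) / (s : ℂ) := by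
      simp [hP, exec_seq, exec_store, store_mem, Expr.eval, IdxExpr.eval, a1, a2, a3, hs]
    rw [e34, e35]
    refine ⟨by rw [Complex.normSq_ofReal, hss], ?_, ?_⟩
    · rw [map_div₀, Complex.normSq_ofReal, hss, div_eq_iff c.ne']
      simp [Complex.normSq_apply]
      linarith
    · rw [show star (s : ℂ) = s from Complex.conj_ofReal s, mul_div_cancel₀ _ hsC]

end RAM

namespace RelayData

/-! ### Entries of the constraint matrices -/

section Entries

variable {K : ℕ} (D : RelayData K)

theorem col_mul_conjTranspose_apply (v : Fin K → ℂ) (i j : Fin K) :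
    (col v * (col v)ᴴ) i j = v i * star (v j) := by
  simp [Matrix.mul_apply]

theorem signalMat_apply (p q : Fin K × Fin K) : D.signalMat p q =
    star (D.hS p.1) * D.hD p.2 * (D.hS q.1 * star (D.hD q.2)) := by
  rw [signalMat, h1, Matrix.conjTranspose_kronecker, ← Matrix.mul_kronecker_mul,
    Matrix.kronecker_apply, col_mul_conjTranspose_apply, col_mul_conjTranspose_apply]
  simp only [Pi.star_apply, star_star]
  ring

theorem jammerMat_apply (p q : Fin K × Fin K) : D.jammerMat p q =
    star (D.hJ p.1) * D.hD p.2 * (D.hJ q.1 * star (D.hD q.2)) := by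
  rw [jammerMat, h2, Matrix.conjTranspose_kronecker, ← Matrix.mul_kronecker_mul,
    Matrix.kronecker_apply, col_mul_conjTranspose_apply, col_mul_conjTranspose_apply]
  simp only [Pi.star_apply, star_star]
  ring

theorem powerMat_apply (p q : Fin K × Fin K) : D.powerMat p q =
    D.PS * (star (D.hS p.1) * D.hS q.1) * (1 : Matrix (Fin K) (Fin K) ℂ) p.2 q.2 +
      D.PJ * (star (D.hJ p.1) * D.hJ q.1) * (1 : Matrix (Fin K) (Fin K) ℂ) p.2 q.2 +
      (1 : Matrix (Fin K) (Fin K) ℂ) p.1 q.1 * (1 : Matrix (Fin K) (Fin K) ℂ) p.2 q.2 := by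
  rw [powerMat, H2, H3, Matrix.conjTranspose_kronecker, ← Matrix.mul_kronecker_mul,
    Matrix.conjTranspose_kronecker, ← Matrix.mul_kronecker_mul, ← Matrix.one_kronecker_one]
  simp only [Matrix.add_apply, Matrix.smul_apply, Matrix.kroneckerMap_apply,
    col_mul_conjTranspose_apply, Pi.star_apply, star_star, Matrix.conjTranspose_one, mul_one,
    smul_eq_mul]
  ring

theorem harvestMat_apply (p q : Fin K × Fin K) : D.harvestMat p q =
    D.PS * (star (D.hS p.1) * D.hS q.1) * (D.hE p.2 * star (D.hE q.2)) +
      D.PJ * (star (D.hJ p.1) * D.hJ q.1) * (D.hE p.2 * star (D.hE q.2)) +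
      (1 : Matrix (Fin K) (Fin K) ℂ) p.1 q.1 * (D.hE p.2 * star (D.hE q.2)) := by
  rw [harvestMat, h3, h4, H4]
  simp only [Matrix.conjTranspose_kronecker, ← Matrix.mul_kronecker_mul, Matrix.add_apply,
    Matrix.smul_apply, Matrix.kroneckerMap_apply, col_mul_conjTranspose_apply, Pi.star_apply,
    star_star, Matrix.conjTranspose_one, mul_one, smul_eq_mul]
  ring

theorem budgetMat_apply (p q : Fin K × Fin K) : D.budgetMat p q =
    D.PJ / D.PS * D.jammerMat p q +
      1 / D.PS * ((1 : Matrix (Fin K) (Fin K) ℂ) p.1 q.1 * (D.hD p.2 * star (D.hD q.2))) +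
      1 / D.PS / D.PRmax * D.powerMat p q := by
  rw [budgetMat, H1, ρ₀, ρ₁, ρ₂]
  simp only [Matrix.conjTranspose_kronecker, ← Matrix.mul_kronecker_mul, Matrix.add_apply,
    Matrix.smul_apply, Matrix.kroneckerMap_apply, col_mul_conjTranspose_apply,
    Matrix.conjTranspose_one, mul_one, smul_eq_mul]
  push_cast
  ring

theorem marginMat_apply (p q : Fin K × Fin K) : D.marginMat p q =
    D.signalMat p q - D.PJ / D.PS / D.ε * D.jammerMat p q := by
  simp [marginMat, ρ₀]

theorem surplusMat_apply (p q : Fin K × Fin K) : D.surplusMat p q =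
    D.harvestMat p q - D.Q / D.PRmax * D.powerMat p q := by
  simp [surplusMat]

end Entries

end RelayData

namespace RAM

/-! ### The program -/

section Program

/-- Array `9` receives the identity matrix of order `K`. -/
def identityProg : Prog := .loop 2 (.reg 0) (.store 9 (.reg 2) (.reg 2) (.const 1))

/-- The entry of a channel vector at the index in register `x`. -/
abbrev ent (a x : ℕ) : Expr := .get a (.reg x) (.const 0)

abbrev par (i : ℕ) : Expr := .get 4 (.const i) (.const 0)

abbrev delta (x y : ℕ) : Expr := .get 9 (.reg x) (.reg y)

/-- Entries of the matrices of the program, at the row given by registers `2` and `3` and the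
column given by registers `4` and `5`. -/
def rankOneExpr (a : ℕ) : Expr :=
  .mul (.mul (.conj (ent a 2)) (ent 2 3)) (.mul (ent a 4) (.conj (ent 2 5)))

def powerExpr : Expr :=
  .add (.add (.mul (.mul (par 0) (.mul (.conj (ent 0 2)) (ent 0 4))) (delta 3 5))
    (.mul (.mul (par 1) (.mul (.conj (ent 1 2)) (ent 1 4))) (delta 3 5)))
    (.mul (delta 2 4) (delta 3 5))

def harvestExpr : Expr :=
  .add (.add
    (.mul (.mul (par 0) (.mul (.conj (ent 0 2)) (ent 0 4))) (.mul (ent 3 3) (.conj (ent 3 5))))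
    (.mul (.mul (par 1) (.mul (.conj (ent 1 2)) (ent 1 4))) (.mul (ent 3 3) (.conj (ent 3 5)))))
    (.mul (delta 2 4) (.mul (ent 3 3) (.conj (ent 3 5))))

def budgetExpr : Expr :=
  .add (.add (.mul (.div (par 1) (par 0)) (rankOneExpr 1))
    (.mul (.div (.const 1) (par 0)) (.mul (delta 2 4) (.mul (ent 2 3) (.conj (ent 2 5))))))
    (.mul (.div (.div (.const 1) (par 0)) (par 2)) powerExpr)

def marginExpr : Expr :=
  .sub (rankOneExpr 0) (.mul (.div (.div (par 1) (par 0)) (par 4)) (rankOneExpr 1))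

def surplusExpr : Expr := .sub harvestExpr (.mul (.div (par 3) (par 2)) powerExpr)

/-- Arrays `10` to `14` receive the matrices of budget, margin, surplus, power and jammer. -/
def setupProg : Prog :=
  .seq identityProg <| .seq (fillKron 10 budgetExpr) <| .seq (fillKron 11 marginExpr) <|
    .seq (fillKron 12 surplusExpr) <| .seq (fillKron 13 powerExpr) (fillKron 14 (rankOneExpr 1))

/-- The values of the form in array `N` at the vectors in arrays `15` and `16`. -/
def gramProg (N t : ℕ) : Prog :=
  .seq (formProg 9 10 N 15 15 t) <|
    .seq (formProg 9 10 N 16 16 (t + 1)) (formProg 9 10 N 15 16 (t + 2))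

/-- Split off column `k` (in register `8`) of the matrix in array `5`. -/
def pivotProg : Prog :=
  .seq (fillVec 9 16 (.div (.get 5 (.reg 9) (.reg 8)) (.sqrt (.get 5 (.reg 8) (.reg 8)))))
    (fillMat 9 10 5 (.sub (.get 5 (.reg 9) (.reg 10)) (.mul (ent 16 9) (.conj (ent 16 10)))))

/-- Merge the vectors in arrays `15` and `16`. -/
def mergeProg : Prog :=
  .seq (gramProg 11 20) <| .seq (gramProg 12 23) <| .seq (gramProg 10 26) <|
  .seq (contrastProg 20 40) <| .seq (contrastProg 23 43) <| .seq (contrastProg 26 46) <|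
  .seq directionProg <| .seq coefficientProg
    (fillVec 9 15 (.add (.mul (cell 34) (ent 15 9)) (.mul (cell 35) (ent 16 9))))

def normSqExpr (e : Expr) : Expr := .mul e (.conj e)

/-- For the zero vector in array `15`: replace it by a vector orthogonal to `h₁` and `h₂`. -/
def replaceProg : Prog :=
  .ite (.reLe (.add (normSqExpr (.get 2 (.const 0) (.const 0)))
      (normSqExpr (.get 2 (.const 1) (.const 0)))) (.const 0))
    (.store 15 (.const 0) (.const 0) (.const 1))
    (.seq (.store 15 (.const 0) (.const 0) (.conj (.get 2 (.const 1) (.const 0))))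
      (.store 15 (.const 1) (.const 0)
        (.sub (.const 0) (.conj (.get 2 (.const 0) (.const 0))))))

def repairProg : Prog :=
  .seq (formProg 9 10 10 15 15 36) <|
  .ite (.reLe (cell 36) (.const 0))
    (.ite (.idxLe (.const 2) (.reg 0)) (.ite (.reLe (par 3) (.const 0)) replaceProg .skip) .skip)
    .skip

def outputProg : Prog :=
  .seq (formProg 9 10 10 15 15 36) <| .seq (formProg 9 10 13 15 15 37) <|
  .seq (formProg 9 10 14 15 15 38) <|
  .seq (fillMat 9 10 7 (.div (.mul (ent 15 9) (.conj (ent 15 10))) (cell 36))) <|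
  .seq (.store 8 (.const 0) (.const 0) (.sqrt (.div (.div (cell 37) (cell 36)) (par 2))))
    (.store 8 (.const 1) (.const 0) (.sqrt (.div (cell 38) (cell 36))))

def mainProg : Prog :=
  .seq setupProg <| .seq (.loop 8 (.reg 1) (.seq pivotProg mergeProg)) <|
    .seq repairProg outputProg

/-- The program that computes a solution of rank at most one. -/
def reductionProg : Prog := .seq squareProg mainProg

/-! ### Its running time -/

/-- Register `1` is written by `squareProg` and is a loop bound only afterwards, so the two halves
are estimated separately, with at most `K` and at most `K²` rounds per loop. -/
theorem reductionProg_time : ∃ C d : ℕ, ∀ (K : ℕ) (σ : State), σ.reg 0 = K →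
    (reductionProg.run σ).2 ≤ C * (K + 1) ^ d := by
  obtain ⟨C₁, d₁, h₁⟩ := exists_timeBound_le squareProg
  obtain ⟨C₂, d₂, h₂⟩ := exists_timeBound_le mainProg
  refine ⟨C₁ + C₂, d₁ + 2 * d₂, fun K σ hσ => ?_⟩
  have e₁ : (squareProg.run σ).2 ≤ C₁ * (K + 1) ^ d₁ :=
    (cost_le_timeBound (B := [0]) (by decide) σ (by simp [hσ])).trans (h₁ K)
  have e₂ : (mainProg.run (squareProg.exec σ)).2 ≤ C₂ * (K * K + 1) ^ d₂ := by
    refine (cost_le_timeBound (B := [0, 1]) (by decide) _ ?_).trans (h₂ (K * K))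
    have r0 : (squareProg.exec σ).reg 0 = K := by
      rw [exec_reg_of_notMem (by decide), hσ]
    simp [r0, squareProg_reg, hσ, Nat.le_mul_self]
  have e₃ : (K * K + 1) ^ d₂ ≤ (K + 1) ^ (2 * d₂) := by
    rw [pow_mul]
    exact Nat.pow_le_pow_left (by nlinarith) _
  have e₄ : (K + 1) ^ d₁ ≤ (K + 1) ^ (d₁ + 2 * d₂) := Nat.pow_le_pow_right (by omega) (by omega)
  have e₅ : (K + 1) ^ (2 * d₂) ≤ (K + 1) ^ (d₁ + 2 * d₂) :=
    Nat.pow_le_pow_right (by omega) (by omega)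
  calc (reductionProg.run σ).2 = (squareProg.run σ).2 + (mainProg.run (squareProg.exec σ)).2 := rfl
    _ ≤ C₁ * (K + 1) ^ d₁ + C₂ * (K * K + 1) ^ d₂ := Nat.add_le_add e₁ e₂
    _ ≤ C₁ * (K + 1) ^ (d₁ + 2 * d₂) + C₂ * (K + 1) ^ (d₁ + 2 * d₂) := 
      Nat.add_le_add (Nat.mul_le_mul_left _ e₄) (Nat.mul_le_mul_left _ (e₃.trans e₅))
    _ = _ := by ring

/-! ### Its correctness -/

open RelayData

/-! ### Data and constraint matrices in memory -/

variable {K : ℕ}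

/-- The data are in memory, with the dimensions in registers `0` and `1`. -/
structure HasData (D : RelayData K) (σ : State) : Prop where
  reg0 : σ.reg 0 = K
  reg1 : σ.reg 1 = K * K
  hS : σ.mem 0 = vecArray D.hS
  hJ : σ.mem 1 = vecArray D.hJ
  hD : σ.mem 2 = vecArray D.hD
  hE : σ.mem 3 = vecArray D.hE
  params : σ.mem 4 = listArray [D.PS, D.PJ, D.PRmax, D.Q, D.ε]

theorem HasData.exec {D : RelayData K} {σ : State} (h : HasData D σ) (P : Prog)
    (hr : ∀ r ∈ [0, 1], r ∉ P.regs) (ha : ∀ a ∈ [0, 1, 2, 3, 4], a ∉ P.arrs) :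
    HasData D (P.exec σ) where
  reg0 := by rw [exec_reg_of_notMem (hr 0 (by simp)), h.reg0]
  reg1 := by rw [exec_reg_of_notMem (hr 1 (by simp)), h.reg1]
  hS := by rw [exec_mem_of_notMem (ha 0 (by simp)), h.hS]
  hJ := by rw [exec_mem_of_notMem (ha 1 (by simp)), h.hJ]
  hD := by rw [exec_mem_of_notMem (ha 2 (by simp)), h.hD]
  hE := by rw [exec_mem_of_notMem (ha 3 (by simp)), h.hE]
  params := by rw [exec_mem_of_notMem (ha 4 (by simp)), h.params]

theorem vecArray_apply (v : Fin K → ℂ) (i : Fin K) : vecArray v i 0 = v i := by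
  simp [vecArray]

theorem identityProg_mem {σ : State} (hσ : σ.reg 0 = K) (hz : σ.mem 9 = fun _ _ => 0)
    (i j : Fin K) : (identityProg.exec σ).mem 9 i j = (1 : Matrix (Fin K) (Fin K) ℂ) i j := by
  have h := loop_inv (x := 2) (e := .reg 0) (σ := σ) (p := .store 9 (.reg 2) (.reg 2) (.const 1))
    (fun k m => ∀ i j, m 9 i j = if i < k ∧ i = j then 1 else 0) (by simp [hz])
    (fun k _ τ _ hx hP i j => ?_) i j
  · rw [identityProg, h]
    simp [IdxExpr.eval, hσ, Matrix.one_apply, Fin.ext_iff]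
  · rw [exec_store, store_mem, hP]
    simp only [IdxExpr.eval, hx, Expr.eval, true_and, Rat.cast_one]
    by_cases hi : i = k
    · subst hi
      simp [eq_comm]
    · have : i < k + 1 ↔ i < k := by omega
      simp [hi, this]

theorem fillKron_holdsMat {D : RelayData K} {σ : State} (hσ : HasData D σ)
    (h9 : ∀ i j : Fin K, σ.mem 9 i j = (1 : Matrix (Fin K) (Fin K) ℂ) i j) {a : ℕ} (ha : 9 < a)
    {e : Expr} {M : Var K}
    (he : ∀ (p q : Fin K × Fin K) (τ : State), τ.mem 0 = vecArray D.hS → τ.mem 1 = vecArray D.hJ →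
      τ.mem 2 = vecArray D.hD → τ.mem 3 = vecArray D.hE →
      τ.mem 4 = listArray [D.PS, D.PJ, D.PRmax, D.Q, D.ε] →
      (∀ i j : Fin K, τ.mem 9 i j = (1 : Matrix (Fin K) (Fin K) ℂ) i j) →
      τ.reg 2 = p.1 → τ.reg 3 = p.2 → τ.reg 4 = q.1 → τ.reg 5 = q.2 → e.eval τ = M p q) :
    HoldsMat (((fillKron a e).exec σ).mem a) M := by
  intro p q
  rw [idx_eq, idx_eq]
  -- The entries of `M`, as a function of natural numbers, are continued by `0` outside the index
  -- range.
  have := fillKron_mem (e := e) (a := a) (f := fun i j k l =>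
    if h : (i < K ∧ j < K) ∧ k < K ∧ l < K then
      M (⟨i, h.1.1⟩, ⟨j, h.1.2⟩) (⟨k, h.2.1⟩, ⟨l, h.2.2⟩) else 0) hσ.reg0
    (fun i hi j hj k hk l hl τ hτ h2 h3 h4 h5 => ?_) p.1.2 p.2.2 q.1.2 q.2.2
  · rw [this]
    simp
  · rw [dif_pos ⟨⟨hi, hj⟩, hk, hl⟩]
    refine he _ _ τ ?_ ?_ ?_ ?_ ?_ (fun i j => ?_) h2 h3 h4 h5
    · rw [hτ _ (by omega), hσ.hS]
    · rw [hτ _ (by omega), hσ.hJ]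
    · rw [hτ _ (by omega), hσ.hD]
    · rw [hτ _ (by omega), hσ.hE]
    · rw [hτ _ (by omega), hσ.params]
    · rw [hτ _ (by omega), h9]

/-- The matrices are in memory. -/
structure HasMats (D : RelayData K) (σ : State) : Prop extends HasData D σ where
  budget : HoldsMat (σ.mem 10) D.budgetMat
  margin : HoldsMat (σ.mem 11) D.marginMat
  surplus : HoldsMat (σ.mem 12) D.surplusMat
  power : HoldsMat (σ.mem 13) D.powerMat
  jammer : HoldsMat (σ.mem 14) D.jammerMat

theorem setupProg_holds {D : RelayData K} {σ : State} (hσ : HasData D σ)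
    (hz : σ.mem 9 = fun _ _ => 0) : HasMats D (setupProg.exec σ) := by
  -- Filling an array beyond `9` disturbs neither the data nor the identity matrix, on which the
  -- later fills depend.
  have key : ∀ {a : ℕ} {e : Expr} {τ : State}, 9 < a → (HasData D τ ∧ ∀ i j : Fin K,
      τ.mem 9 i j = (1 : Matrix (Fin K) (Fin K) ℂ) i j) →
      HasData D ((fillKron a e).exec τ) ∧ ∀ i j : Fin K,
      ((fillKron a e).exec τ).mem 9 i j = (1 : Matrix (Fin K) (Fin K) ℂ) i j := by
    intro a e τ ha h
    refine ⟨h.1.exec _ ?_ ?_, fun i j => ?_⟩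
    · simp [fillKron, pairLoop, Prog.regs]
    · simp [fillKron, pairLoop, Prog.arrs]; omega
    · rw [exec_mem_of_notMem]
      · exact h.2 i j
      · simp [fillKron, pairLoop, Prog.arrs]; omega
  have h₀ : HasData D (identityProg.exec σ) ∧ ∀ i j : Fin K,
      (identityProg.exec σ).mem 9 i j = (1 : Matrix (Fin K) (Fin K) ℂ) i j :=
    ⟨hσ.exec _ (by decide) (by decide), identityProg_mem hσ.reg0 hz⟩
  have h₁ := key (a := 10) (e := budgetExpr) (by omega) h₀
  have h₂ := key (a := 11) (e := marginExpr) (by omega) h₁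
  have h₃ := key (a := 12) (e := surplusExpr) (by omega) h₂
  have h₄ := key (a := 13) (e := powerExpr) (by omega) h₃
  have h₅ := key (a := 14) (e := rankOneExpr 1) (by omega) h₄
  refine ⟨h₅.1, ?_, ?_, ?_, ?_, ?_⟩ <;> simp only [setupProg, exec_seq]
  · rw [exec_mem_of_notMem (by decide), exec_mem_of_notMem (by decide),
      exec_mem_of_notMem (by decide), exec_mem_of_notMem (by decide)]
    refine fillKron_holdsMat h₀.1 h₀.2 (by omega) fun p q τ m0 m1 m2 m3 m4 m9 r2 r3 r4 r5 => ?_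
    rw [budgetMat_apply, jammerMat_apply, powerMat_apply]
    simp [budgetExpr, rankOneExpr, powerExpr, Expr.eval, IdxExpr.eval, m0, m1, m2, m4, m9, r2, r3,
      r4, r5, vecArray_apply, listArray]
  · rw [exec_mem_of_notMem (by decide), exec_mem_of_notMem (by decide),
      exec_mem_of_notMem (by decide)]
    refine fillKron_holdsMat h₁.1 h₁.2 (by omega) fun p q τ m0 m1 m2 m3 m4 m9 r2 r3 r4 r5 => ?_
    rw [marginMat_apply, jammerMat_apply, signalMat_apply]
    simp [marginExpr, rankOneExpr, Expr.eval, IdxExpr.eval, m0, m1, m2, m4, r2, r3,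
      r4, r5, vecArray_apply, listArray]
  · rw [exec_mem_of_notMem (by decide), exec_mem_of_notMem (by decide)]
    refine fillKron_holdsMat h₂.1 h₂.2 (by omega) fun p q τ m0 m1 m2 m3 m4 m9 r2 r3 r4 r5 => ?_
    rw [surplusMat_apply, harvestMat_apply, powerMat_apply]
    simp [surplusExpr, harvestExpr, powerExpr, Expr.eval, IdxExpr.eval, m0, m1, m3, m4, m9, r2,
      r3, r4, r5, vecArray_apply, listArray]
  · rw [exec_mem_of_notMem (by decide)]
    refine fillKron_holdsMat h₃.1 h₃.2 (by omega) fun p q τ m0 m1 m2 m3 m4 m9 r2 r3 r4 r5 => ?_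
    rw [powerMat_apply]
    simp [powerExpr, Expr.eval, IdxExpr.eval, m0, m1, m4, m9, r2, r3, r4, r5, vecArray_apply,
      listArray]
  · refine fillKron_holdsMat h₄.1 h₄.2 (by omega) fun p q τ m0 m1 m2 m3 m4 m9 r2 r3 r4 r5 => ?_
    rw [jammerMat_apply]
    simp [rankOneExpr, Expr.eval, IdxExpr.eval, m1, m2, r2, r3, r4, r5, vecArray_apply]

theorem HasMats.exec {D : RelayData K} {σ : State} (h : HasMats D σ) (P : Prog)
    (hr : ∀ r ∈ [0, 1], r ∉ P.regs)
    (ha : ∀ a ∈ [0, 1, 2, 3, 4, 10, 11, 12, 13, 14], a ∉ P.arrs) : HasMats D (P.exec σ) where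
  toHasData := h.toHasData.exec P hr fun a ha' => ha a (by simp at ha' ⊢; tauto)
  budget := by rw [exec_mem_of_notMem (ha 10 (by simp))]; exact h.budget
  margin := by rw [exec_mem_of_notMem (ha 11 (by simp))]; exact h.margin
  surplus := by rw [exec_mem_of_notMem (ha 12 (by simp))]; exact h.surplus
  power := by rw [exec_mem_of_notMem (ha 13 (by simp))]; exact h.power
  jammer := by rw [exec_mem_of_notMem (ha 14 (by simp))]; exact h.jammer

theorem HasMats.of_agree {D : RelayData K} {σ τ : State} (h : HasMats D σ) {as rs : List ℕ}
    (hA : Agree as rs σ τ) (hr : ∀ r ∈ [0, 1], r ∉ rs)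
    (ha : ∀ a ∈ [0, 1, 2, 3, 4, 10, 11, 12, 13, 14], a ∉ as) : HasMats D τ where
  reg0 := by rw [hA.2 _ (hr 0 (by simp)), h.reg0]
  reg1 := by rw [hA.2 _ (hr 1 (by simp)), h.reg1]
  hS := by rw [hA.1 _ (ha 0 (by simp)), h.hS]
  hJ := by rw [hA.1 _ (ha 1 (by simp)), h.hJ]
  hD := by rw [hA.1 _ (ha 2 (by simp)), h.hD]
  hE := by rw [hA.1 _ (ha 3 (by simp)), h.hE]
  params := by rw [hA.1 _ (ha 4 (by simp)), h.params]
  budget := by rw [hA.1 _ (ha 10 (by simp))]; exact h.budget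
  margin := by rw [hA.1 _ (ha 11 (by simp))]; exact h.margin
  surplus := by rw [hA.1 _ (ha 12 (by simp))]; exact h.surplus
  power := by rw [hA.1 _ (ha 13 (by simp))]; exact h.power
  jammer := by rw [hA.1 _ (ha 14 (by simp))]; exact h.jammer

/-- The pivot column is copied to array `16` before array `5` changes, so the subtraction can be
done in place. -/
theorem pivotProg_holds {σ : State} (hσ : σ.reg 1 = K * K) {Y : Var K} {k : Fin K × Fin K}
    (hk : σ.reg 8 = idx k) (hY : HoldsMat (σ.mem 5) Y) :
    HoldsVec ((pivotProg.exec σ).mem 16) (pivotVec Y k) ∧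
      HoldsMat ((pivotProg.exec σ).mem 5) (Y - outer (pivotVec Y k)) := by
  rw [pivotProg, exec_seq]
  set P := fillVec 9 16 (.div (.get 5 (.reg 9) (.reg 8)) (.sqrt (.get 5 (.reg 8) (.reg 8)))) with hP
  have h1 : HoldsVec ((P.exec σ).mem 16) (pivotVec Y k) := by
    intro p
    rw [hP, fillVec_mem (f := fun i => σ.mem 5 i (idx k) / ((Real.sqrt (Y k k).re : ℝ) : ℂ)),
      if_pos ⟨hσ ▸ idx_lt p, rfl⟩, hY, pivotVec]
    intro i hi τ hA h9 _
    have h8 : τ.reg 8 = idx k := by rw [hA.2 8 (by simp), hk]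
    have h5 : τ.mem 5 = σ.mem 5 := hA.1 5 (by simp)
    simp [Expr.eval, IdxExpr.eval, h8, h9, h5, hY k k]
  have h2 : (P.exec σ).mem 5 = σ.mem 5 := exec_mem_of_notMem (by decide) σ
  have h3 : (P.exec σ).reg 1 = K * K := by rw [exec_reg_of_notMem (by decide), hσ]
  generalize P.exec σ = σ₁ at h1 h2 h3 ⊢
  refine ⟨?_, fun p q => ?_⟩
  · rw [exec_mem_of_notMem (by decide)]; exact h1
  · rw [fillMat_mem (f := fun i j => σ.mem 5 i j - σ₁.mem 16 i 0 * star (σ₁.mem 16 j 0))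
      (by decide) (by decide) (by decide), if_pos ⟨h3 ▸ idx_lt p, h3 ▸ idx_lt q⟩, hY, h1, h1]
    · rfl
    · intro i hi j hj τ hA h9 h10 hm
      have h16 : τ.mem 16 = σ₁.mem 16 := hA.1 16 (by simp)
      simp [Expr.eval, IdxExpr.eval, h9, h10, h16, hm, h2]

theorem gramProg_holds {σ : State} (hσ : σ.reg 1 = K * K) {N t : ℕ} {M : Var K}
    {u v : Fin K × Fin K → ℂ} (hN : N < 15) (ht : 16 < t) (hM : HoldsMat (σ.mem N) M)
    (hu : HoldsVec (σ.mem 15) u) (hv : HoldsVec (σ.mem 16) v) :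
    ((gramProg N t).exec σ).mem t 0 0 = sform M u u ∧
      ((gramProg N t).exec σ).mem (t + 1) 0 0 = sform M v v ∧
      ((gramProg N t).exec σ).mem (t + 2) 0 0 = sform M u v := by
  have arrs : ∀ x y s, (formProg 9 10 N x y s).arrs = [s, s] := fun _ _ _ => rfl
  have keep : ∀ {x y s a : ℕ} (τ : State), a ≠ s →
      ((formProg 9 10 N x y s).exec τ).mem a = τ.mem a :=
    fun τ h => exec_mem_of_notMem (by simp [arrs, h]) τ
  have regs : ∀ {x y s : ℕ} (τ : State),
      ((formProg 9 10 N x y s).exec τ).reg 1 = τ.reg 1 :=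
    fun τ => exec_reg_of_notMem (by simp [formProg, Prog.regs]) τ
  simp only [gramProg, exec_seq]
  refine ⟨?_, ?_, ?_⟩
  · rw [keep _ (by omega), keep _ (by omega)]
    exact formProg_eq_sform hσ (by decide) (by decide) (by decide) (by omega) (by omega)
      (by omega) hM hu hu
  · rw [keep _ (by omega)]
    refine formProg_eq_sform (by rw [regs, hσ]) (by decide) (by decide) (by decide) (by omega)
      (by omega) (by omega) ?_ ?_ ?_ <;> rw [keep _ (by omega)] <;> assumption
  · refine formProg_eq_sform (by rw [regs, regs, hσ]) (by decide) (by decide) (by decide)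
      (by omega) (by omega) (by omega) ?_ ?_ ?_ <;> rw [keep _ (by omega), keep _ (by omega)] <;>
      assumption

/-- This displays the contrast as an inner product in `ℝ³`, so that the three conditions of a merge
become those met by `directionProg`. -/
theorem contrast_eq (N : Var K) (u v : Fin K × Fin K → ℂ) (w₁ w₂ w₃ : ℝ) :
    contrast N u v w₁ (w₂ + Complex.I * w₃) = w₁ * ((sform N u u).re - (sform N v v).re) +
      w₂ * (2 * (sform N u v).re) + w₃ * (-2 * (sform N u v).im) := by
  simp [contrast]
  ring

/-- The nine form values yield one vector of `ℝ³` for each of margin, surplus and budget. The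
direction is orthogonal to the first two and has a nonnegative product with the third. The rest of
the argument is the bookkeeping of which cells each subprogram leaves alone. -/
theorem mergeProg_holds {D : RelayData K} {σ : State} (hσ : HasMats D σ)
    {u v : Fin K × Fin K → ℂ} (hu : HoldsVec (σ.mem 15) u) (hv : HoldsVec (σ.mem 16) v) :
    ∃ (g h : ℂ) (a : ℝ), HoldsVec ((mergeProg.exec σ).mem 15) (g • u + h • v) ∧
      Complex.normSq g = 1 + a ∧ Complex.normSq h = 1 - a ∧
      contrast D.marginMat u v a (star g * h) = 0 ∧
      contrast D.surplusMat u v a (star g * h) = 0 ∧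
      0 ≤ contrast D.budgetMat u v a (star g * h) := by
  simp only [mergeProg, exec_seq]
  -- the values of the forms
  obtain ⟨a₁, a₂, a₃⟩ := gramProg_holds hσ.reg1 (N := 11) (t := 20) (by decide) (by decide)
    hσ.margin hu hv
  have i₁ := hσ.exec (gramProg 11 20) (by decide) (by decide)
  have u₁ : ((gramProg 11 20).exec σ).mem 15 = σ.mem 15 := exec_mem_of_notMem (by decide) _
  have v₁ : ((gramProg 11 20).exec σ).mem 16 = σ.mem 16 := exec_mem_of_notMem (by decide) _
  generalize (gramProg 11 20).exec σ = σ₁ at *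
  obtain ⟨b₁, b₂, b₃⟩ := gramProg_holds i₁.reg1 (N := 12) (t := 23) (by decide) (by decide)
    i₁.surplus (u₁ ▸ hu) (v₁ ▸ hv)
  have i₂ := i₁.exec (gramProg 12 23) (by decide) (by decide)
  have f₂ : ∀ a ∈ [15, 16, 20, 21, 22], ((gramProg 12 23).exec σ₁).mem a = σ₁.mem a :=
    fun a ha => exec_mem_of_notMem (by revert a; decide) _
  generalize (gramProg 12 23).exec σ₁ = σ₂ at *
  have u₂ : HoldsVec (σ₂.mem 15) u := by rw [f₂ 15 (by simp), u₁]; exact hu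
  have v₂ : HoldsVec (σ₂.mem 16) v := by rw [f₂ 16 (by simp), v₁]; exact hv
  rw [← f₂ _ (by simp)] at a₁ a₂ a₃
  obtain ⟨c₁, c₂, c₃⟩ := gramProg_holds i₂.reg1 (N := 10) (t := 26) (by decide) (by decide)
    i₂.budget u₂ v₂
  have i₃ := i₂.exec (gramProg 10 26) (by decide) (by decide)
  have f₃ : ∀ a ∈ [15, 16, 20, 21, 22, 23, 24, 25],
      ((gramProg 10 26).exec σ₂).mem a = σ₂.mem a :=
    fun a ha => exec_mem_of_notMem (by revert a; decide) _
  generalize (gramProg 10 26).exec σ₂ = σ₃ at *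
  rw [← f₃ _ (by simp)] at a₁ a₂ a₃ b₁ b₂ b₃ u₂ v₂
  -- the contrasts
  have p₁ := contrastProg_holds (σ := σ₃) (s := 20) (t := 40) (by decide) a₁ a₂ a₃
  have f₄ : ∀ a ∈ [15, 16, 23, 24, 25, 26, 27, 28],
      ((contrastProg 20 40).exec σ₃).mem a = σ₃.mem a :=
    fun a ha => exec_mem_of_notMem (by revert a; decide) _
  have i₄ := i₃.exec (contrastProg 20 40) (by decide) (by decide)
  generalize (contrastProg 20 40).exec σ₃ = σ₄ at *
  rw [← f₄ _ (by simp)] at b₁ b₂ b₃ c₁ c₂ c₃ u₂ v₂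
  have q₁ := contrastProg_holds (σ := σ₄) (s := 23) (t := 43) (by decide) b₁ b₂ b₃
  have f₅ : ∀ a ∈ [15, 16, 26, 27, 28, 40, 41, 42],
      ((contrastProg 23 43).exec σ₄).mem a = σ₄.mem a :=
    fun a ha => exec_mem_of_notMem (by revert a; decide) _
  have i₅ := i₄.exec (contrastProg 23 43) (by decide) (by decide)
  generalize (contrastProg 23 43).exec σ₄ = σ₅ at *
  rw [← f₅ _ (by simp)] at c₁ c₂ c₃ u₂ v₂
  replace p₁ := p₁.of_mem_eq (f₅ _ (by simp)) (f₅ _ (by simp)) (f₅ _ (by simp))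
  have r₁ := contrastProg_holds (σ := σ₅) (s := 26) (t := 46) (by decide) c₁ c₂ c₃
  have f₆ : ∀ a ∈ [15, 16, 40, 41, 42, 43, 44, 45],
      ((contrastProg 26 46).exec σ₅).mem a = σ₅.mem a :=
    fun a ha => exec_mem_of_notMem (by revert a; decide) _
  have i₆ := i₅.exec (contrastProg 26 46) (by decide) (by decide)
  generalize (contrastProg 26 46).exec σ₅ = σ₆ at *
  rw [← f₆ _ (by simp)] at u₂ v₂
  replace p₁ := p₁.of_mem_eq (f₆ _ (by simp)) (f₆ _ (by simp)) (f₆ _ (by simp))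
  replace q₁ := q₁.of_mem_eq (f₆ _ (by simp)) (f₆ _ (by simp)) (f₆ _ (by simp))
  -- the direction and the coefficients
  obtain ⟨w₁, w₂, w₃, hw, op, oq, or, on⟩ := directionProg_holds p₁ q₁ r₁
  have f₇ : ∀ a ∈ [15, 16], (directionProg.exec σ₆).mem a = σ₆.mem a :=
    fun a ha => exec_mem_of_notMem (by revert a; decide) _
  have i₇ := i₆.exec directionProg (by decide) (by decide)
  generalize directionProg.exec σ₆ = σ₇ at *
  rw [← f₇ _ (by simp)] at u₂ v₂
  obtain ⟨g, h, hg, hh, ng, nh, ngh⟩ := coefficientProg_holds hw on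
  have f₈ : ∀ a ∈ [15, 16], (coefficientProg.exec σ₇).mem a = σ₇.mem a :=
    fun a ha => exec_mem_of_notMem (by revert a; decide) _
  have i₈ := i₇.exec coefficientProg (by decide) (by decide)
  generalize coefficientProg.exec σ₇ = σ₈ at *
  rw [← f₈ _ (by simp)] at u₂ v₂
  refine ⟨g, h, w₁, fun p => ?_, ng, nh, ?_, ?_, ?_⟩
  · rw [fillVec_mem (f := fun i => g * σ₈.mem 15 i 0 + h * σ₈.mem 16 i 0),
      if_pos ⟨i₈.reg1 ▸ idx_lt p, rfl⟩, u₂, v₂]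
    · rfl
    · intro i hi τ hA h9 hm
      have m34 : τ.mem 34 = σ₈.mem 34 := hA.1 34 (by simp)
      have m35 : τ.mem 35 = σ₈.mem 35 := hA.1 35 (by simp)
      have m16 : τ.mem 16 = σ₈.mem 16 := hA.1 16 (by simp)
      simp [Expr.eval, IdxExpr.eval, m34, m35, m16, h9, hm, hg, hh]
  · rw [ngh, contrast_eq]; linarith
  · rw [ngh, contrast_eq]; linarith
  · rw [ngh, contrast_eq]; linarith

/-- The invariant is a positive semidefinite remainder `Y` whose first `k` rows vanish, with `u u† +
Y` superoptimal. A round moves the pivot vector from `Y` to `u`: the splitting leaves the sum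
unchanged, and the merge replaces two rank-one terms by one. -/
theorem pivotLoop_holds {D : RelayData K} (hD : D.Admissible) {X : Var K} {b c : ℝ}
    (hX : D.RelaxedOptimal X b c) {σ : State} (hσ : HasMats D σ) (h5 : HoldsMat (σ.mem 5) X)
    (h15 : σ.mem 15 = fun _ _ => 0) :
    ∃ u : Fin K × Fin K → ℂ,
      HoldsVec (((Prog.loop 8 (.reg 1) (.seq pivotProg mergeProg)).exec σ).mem 15) u ∧
      Superoptimal D.budgetMat D.marginMat D.surplusMat D.signalMat (D.objective X)
        (pairing D.budgetMat X) (outer u) := by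
  have h := loop_inv (x := 8) (e := .reg 1) (σ := σ) (p := .seq pivotProg mergeProg)
    (fun k m => ∃ (Y : Var K) (u : Fin K × Fin K → ℂ), HoldsMat (m 5) Y ∧ HoldsVec (m 15) u ∧
      Y.PosSemidef ∧ (∀ p, idx p < k → ∀ q, Y p q = 0) ∧
      Superoptimal D.budgetMat D.marginMat D.surplusMat D.signalMat (D.objective X)
        (pairing D.budgetMat X) (outer u + Y))
    -- Array `15` is initially zero, so the process starts with `u = 0` and `Y = X`.
    ⟨X, 0, h5, fun p => by simp [h15], hX.1.psd, by simp, by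
      rw [outer_eq_zero.2 rfl, zero_add]; exact hX.superoptimal hD⟩ ?_
  · simp only [IdxExpr.eval, hσ.reg1] at h
    obtain ⟨Y, u, -, hu, -, hz, hs⟩ := h
    have hY : Y = 0 := Matrix.ext fun p q => hz p (idx_lt p) q
    rw [hY, add_zero] at hs
    exact ⟨u, hu, hs⟩
  · intro k hk τ hA h8 ⟨Y, u, hY, hu, hpsd, hz, hs⟩
    simp only [IdxExpr.eval, hσ.reg1] at hk
    obtain ⟨p₀, hp₀⟩ := exists_idx_eq hk
    have hτ : HasMats D τ := hσ.of_agree hA (by decide) (by decide)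
    rw [exec_seq]
    obtain ⟨hv, hY'⟩ := pivotProg_holds hτ.reg1 (h8.trans hp₀.symm) hY
    have hτ₁ := hτ.exec pivotProg (by decide) (by decide)
    have hu₁ : HoldsVec ((pivotProg.exec τ).mem 15) u := by
      rw [exec_mem_of_notMem (by decide)]; exact hu
    generalize pivotProg.exec τ = τ₁ at *
    obtain ⟨g, h, a, hx, ng, nh, cB, cC, cA⟩ := mergeProg_holds hτ₁ hu₁ hv
    have hpsd' := sub_outer_pivotVec_posSemidef hpsd p₀
    refine ⟨Y - outer (pivotVec Y p₀), g • u + h • pivotVec Y p₀, ?_, hx, hpsd', ?_, ?_⟩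
    · rw [exec_mem_of_notMem (by decide)]; exact hY'
    · intro p hp q
      by_cases hpk : p = p₀
      · rw [hpk, pivotVec_row hpsd]
      · have hlt : idx p < k := by
          have : idx p ≠ k := fun h => hpk (idx_injective (h.trans hp₀.symm))
          omega
        -- Rows cleared earlier stay zero, because the pivot vector vanishes there too.
        simp [outer_apply, hz p hlt, pivotVec_apply_eq_zero (hz p hlt)]
    · refine Superoptimal.merge D.budgetMat_isHermitian D.marginMat_isHermitian
        D.surplusMat_isHermitian (fun W hW hm hsu => hX.signal_le hD hW hm hsu) hpsd' ng nh cB cC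
        cA ?_
      rwa [add_sub_cancel]

/-- Here `N = f f†`, and `f† u = 0` gives `N u = 0`. -/
theorem sform_eq_zero_of_rankOne {N : Var K} {f u : Fin K × Fin K → ℂ}
    (hN : ∀ p q, N p q = f p * star (f q)) (h : ∑ q, star (f q) * u q = 0) : sform N u u = 0 := by
  refine Finset.sum_eq_zero fun p _ => ?_
  have : ∀ q, star (u p) * N p q * u q = star (u p) * f p * (star (f q) * u q) := fun q => by
    rw [hN]; ring
  simp only [this, ← Finset.mul_sum, h, mul_zero]

/-- If `w` is orthogonal to `h_D`, then `e₀ ⊗ w` is orthogonal to `x^* ⊗ h_D` for every `x`, hence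
to `h₁` and `h₂`. Two coordinates suffice for `w`: `(conj d₁, -conj d₀)` with `d₀, d₁` the first two
entries of `h_D`, or `(1, 0)` if both vanish. -/
theorem replaceProg_holds {D : RelayData K} (hD : D.Admissible) (hK : 2 ≤ K) (hQ : D.Q ≤ 0)
    {σ : State} (hσ : HasData D σ) (h15 : HoldsVec (K := K) (σ.mem 15) 0) :
    ∃ u : Fin K × Fin K → ℂ, HoldsVec ((replaceProg.exec σ).mem 15) u ∧ D.Solves 0 u := by
  set p₀ : Fin K × Fin K := (⟨0, by omega⟩, ⟨0, by omega⟩) with hp₀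
  set p₁ : Fin K × Fin K := (⟨0, by omega⟩, ⟨1, by omega⟩) with hp₁
  have hne : p₀ ≠ p₁ := by simp [hp₀, hp₁]
  have i₀ : idx p₀ = 0 := by simp [idx_eq, hp₀]
  have i₁ : idx p₁ = 1 := by simp [idx_eq, hp₁]
  have hidx : ∀ p : Fin K × Fin K, p ≠ p₀ → idx p ≠ 0 := fun p hp h =>
    hp (idx_injective (h.trans i₀.symm))
  have hidx' : ∀ p : Fin K × Fin K, p ≠ p₁ → idx p ≠ 1 := fun p hp h =>
    hp (idx_injective (h.trans i₁.symm))
  have d₀ : σ.mem 2 0 0 = D.hD p₀.2 := by rw [hσ.hD]; exact vecArray_apply D.hD p₀.2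
  have d₁ : σ.mem 2 1 0 = D.hD p₁.2 := by rw [hσ.hD]; exact vecArray_apply D.hD p₁.2
  -- it suffices to annihilate the first two entries of `h_D`
  suffices h : ∃ α β : ℂ, HoldsVec ((replaceProg.exec σ).mem 15)
      (Pi.single p₀ α + Pi.single p₁ β) ∧ ¬ (α = 0 ∧ β = 0) ∧
      star (D.hD p₀.2) * α + star (D.hD p₁.2) * β = 0 by
    obtain ⟨α, β, hu, hαβ, h0⟩ := h
    have hsum : ∀ x : Fin K → ℂ, ∑ q, star (star (x q.1) * D.hD q.2) *
        (Pi.single p₀ α + Pi.single p₁ β : Fin K × Fin K → ℂ) q = 0 := by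
      intro x
      simp only [Pi.add_apply, mul_add, Finset.sum_add_distrib, Pi.single_apply, mul_ite, mul_zero,
        Finset.sum_ite_eq', Finset.mem_univ, if_true, star_mul', star_star]
      have : x p₁.1 = x p₀.1 := rfl
      rw [this]
      linear_combination x p₀.1 * h0
    refine ⟨_, hu, solves_of_orthogonal hD hQ (fun hz => hαβ ⟨?_, ?_⟩) ?_ ?_⟩
    · simpa [hne] using congrFun hz p₀
    · simpa [hne.symm] using congrFun hz p₁
    · rw [pairing_outer, sform_eq_zero_of_rankOne (fun p q => ?_) (hsum D.hS), Complex.zero_re]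
      rw [signalMat_apply, star_mul', star_star]
    · rw [pairing_outer, sform_eq_zero_of_rankOne (fun p q => ?_) (hsum D.hJ), Complex.zero_re]
      rw [jammerMat_apply, star_mul', star_star]
  have hcond : (Cond.reLe (.add (normSqExpr (.get 2 (.const 0) (.const 0)))
      (normSqExpr (.get 2 (.const 1) (.const 0)))) (.const 0)).Holds σ ↔
      Complex.normSq (D.hD p₀.2) + Complex.normSq (D.hD p₁.2) ≤ 0 := by
    simp [Cond.Holds, normSqExpr, Expr.eval, IdxExpr.eval, d₀, d₁, Complex.normSq_apply]
  by_cases c : (Cond.reLe (.add (normSqExpr (.get 2 (.const 0) (.const 0)))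
      (normSqExpr (.get 2 (.const 1) (.const 0)))) (.const 0)).Holds σ
  · rw [replaceProg, exec_ite_pos c]
    rw [hcond] at c
    have n₀ := Complex.normSq_nonneg (D.hD p₀.2)
    have n₁ := Complex.normSq_nonneg (D.hD p₁.2)
    have z₀ : D.hD p₀.2 = 0 := Complex.normSq_eq_zero.1 (by linarith)
    have z₁ : D.hD p₁.2 = 0 := Complex.normSq_eq_zero.1 (by linarith)
    refine ⟨1, 0, fun p => ?_, by simp, by simp [z₀]⟩
    rw [exec_store, store_mem, h15]
    by_cases h : p = p₀
    · subst h; simp [i₀, IdxExpr.eval, Expr.eval]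
    · simp [hidx p h, h, IdxExpr.eval]
  · rw [replaceProg, exec_ite_neg c]
    rw [hcond] at c
    refine ⟨star (D.hD p₁.2), -star (D.hD p₀.2), fun p => ?_, fun h => c ?_, by ring⟩
    · rw [exec_seq, exec_store, exec_store, store_mem, store_mem, h15]
      by_cases h : p = p₀
      · subst h; simp [i₀, IdxExpr.eval, Expr.eval, d₁, hne]
      · by_cases h' : p = p₁
        · subst h'; simp [i₁, IdxExpr.eval, Expr.eval, store_mem, d₀, hne.symm]
        · simp [hidx p h, hidx' p h', h, h', IdxExpr.eval]
    · have z₁ : D.hD p₁.2 = 0 := by simpa using h.1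
      have z₀ : D.hD p₀.2 = 0 := by simpa using h.2
      simp [z₀, z₁]

/-- The budget form is definite, so one comparison of its value with `0` decides whether `u = 0`.
Then `X = 0` too, and the replacement is needed only for `K ≥ 2` and `Q ≤ 0`. -/
theorem repairProg_holds {D : RelayData K} (hD : D.Admissible) {X : Var K} {b c : ℝ}
    (hX : D.RelaxedOptimal X b c) {σ : State} (hσ : HasMats D σ) {u : Fin K × Fin K → ℂ}
    (hu : HoldsVec (σ.mem 15) u)
    (hs : Superoptimal D.budgetMat D.marginMat D.surplusMat D.signalMat (D.objective X)
      (pairing D.budgetMat X) (outer u)) :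
    ∃ u' : Fin K × Fin K → ℂ, HoldsVec ((repairProg.exec σ).mem 15) u' ∧ D.Solves X u' := by
  rw [repairProg, exec_seq]
  have h36 : ((formProg 9 10 10 15 15 36).exec σ).mem 36 0 0 = sform D.budgetMat u u :=
    formProg_eq_sform hσ.reg1 (by decide) (by decide) (by decide) (by decide) (by decide)
      (by decide) hσ.budget hu hu
  have hσ₁ := hσ.exec (formProg 9 10 10 15 15 36) (by decide) (by decide)
  have hu₁ : HoldsVec (((formProg 9 10 10 15 15 36).exec σ).mem 15) u := by
    rw [exec_mem_of_notMem (by decide)]; exact hu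
  generalize (formProg 9 10 10 15 15 36).exec σ = τ at *
  by_cases c₁ : (Cond.reLe (cell 36) (.const 0)).Holds τ
  swap
  · rw [exec_ite_neg c₁]
    refine ⟨u, hu₁, hs.solves hD hX fun h => absurd ?_ c₁⟩
    simp [Cond.Holds, Expr.eval, IdxExpr.eval, h36, h, sform]
  rw [exec_ite_pos c₁]
  simp only [Cond.Holds, Expr.eval, IdxExpr.eval, h36, Rat.cast_zero, Complex.zero_re] at c₁
  rw [← pairing_outer] at c₁
  have hu0 : u = 0 := outer_eq_zero.1
    (eq_zero_of_pairing_budgetMat_nonpos hD (outer_posSemidef u) c₁)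
  by_cases c₂ : (Cond.idxLe (.const 2) (.reg 0)).Holds τ
  swap
  · rw [exec_ite_neg c₂]
    simp only [Cond.Holds, IdxExpr.eval, hσ₁.reg0] at c₂
    exact ⟨u, hu₁, hs.solves hD hX fun _ h => c₂ h.1⟩
  rw [exec_ite_pos c₂]
  simp only [Cond.Holds, IdxExpr.eval, hσ₁.reg0] at c₂
  have h3 : (Cond.reLe (par 3) (.const 0)).Holds τ ↔ D.Q ≤ 0 := by
    simp [Cond.Holds, Expr.eval, IdxExpr.eval, hσ₁.params, listArray]
  by_cases c₃ : (Cond.reLe (par 3) (.const 0)).Holds τ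
  · rw [exec_ite_pos c₃]
    have hX0 : X = 0 := by
      refine eq_zero_of_pairing_budgetMat_nonpos hD hX.1.psd ?_
      have := hs.size
      rwa [hu0, outer_eq_zero.2 rfl, pairing_zero_right] at this
    subst hu0 hX0
    exact replaceProg_holds hD c₂ (h3.1 c₃) hσ₁.toHasData hu₁
  · rw [exec_ite_neg c₃]
    exact ⟨u, hu₁, hs.solves hD hX fun _ h => c₃ (h3.2 h.2)⟩

/-- The Hermitian forms have real values at `u`, so the cells hold the pairings themselves. Division
by `0` on the machine agrees with the inverse in `hXs`, so `u = 0` is no exception. -/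
theorem outputProg_shows {D : RelayData K} {σ : State} (hσ : HasMats D σ)
    {u : Fin K × Fin K → ℂ} (hu : HoldsVec (σ.mem 15) u) {Xs : Var K}
    (hXs : Xs = (((pairing D.budgetMat (outer u))⁻¹ : ℝ) : ℂ) • outer u) :
    (outputProg.exec σ).Shows Xs (Real.sqrt (pairing D.powerMat Xs / D.PRmax))
      (Real.sqrt (pairing D.jammerMat Xs)) := by
  have hpair : ∀ {N : Var K}, N.IsHermitian →
      sform N u u = (pairing N (outer u) : ℂ) := fun hN => by
    rw [pairing_outer]; exact sform_self_eq_ofReal hN u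
  simp only [outputProg, exec_seq]
  have a₁ : ((formProg 9 10 10 15 15 36).exec σ).mem 36 0 0 = _ :=
    (formProg_eq_sform hσ.reg1 (by decide) (by decide) (by decide) (by decide) (by decide)
      (by decide) hσ.budget hu hu).trans (hpair D.budgetMat_isHermitian)
  have i₁ := hσ.exec (formProg 9 10 10 15 15 36) (by decide) (by decide)
  have u₁ : HoldsVec (((formProg 9 10 10 15 15 36).exec σ).mem 15) u := by
    rw [exec_mem_of_notMem (by decide)]; exact hu
  generalize (formProg 9 10 10 15 15 36).exec σ = σ₁ at *
  have b₁ : ((formProg 9 10 13 15 15 37).exec σ₁).mem 37 0 0 = _ :=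
    (formProg_eq_sform i₁.reg1 (by decide) (by decide) (by decide) (by decide) (by decide)
      (by decide) i₁.power u₁ u₁).trans (hpair D.powerMat_isHermitian)
  have i₂ := i₁.exec (formProg 9 10 13 15 15 37) (by decide) (by decide)
  have u₂ : HoldsVec (((formProg 9 10 13 15 15 37).exec σ₁).mem 15) u := by
    rw [exec_mem_of_notMem (by decide)]; exact u₁
  have a₂ : ((formProg 9 10 13 15 15 37).exec σ₁).mem 36 0 0 = _ :=
    (congrFun (congrFun (exec_mem_of_notMem (by decide) σ₁) 0) 0).trans a₁
  generalize (formProg 9 10 13 15 15 37).exec σ₁ = σ₂ at *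
  have c₁ : ((formProg 9 10 14 15 15 38).exec σ₂).mem 38 0 0 = _ :=
    (formProg_eq_sform i₂.reg1 (by decide) (by decide) (by decide) (by decide) (by decide)
      (by decide) i₂.jammer u₂ u₂).trans (hpair D.jammerMat_isHermitian)
  have i₃ := i₂.exec (formProg 9 10 14 15 15 38) (by decide) (by decide)
  have u₃ : HoldsVec (((formProg 9 10 14 15 15 38).exec σ₂).mem 15) u := by
    rw [exec_mem_of_notMem (by decide)]; exact u₂
  have a₃ : ((formProg 9 10 14 15 15 38).exec σ₂).mem 36 0 0 = _ :=
    (congrFun (congrFun (exec_mem_of_notMem (by decide) σ₂) 0) 0).trans a₂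
  have b₃ : ((formProg 9 10 14 15 15 38).exec σ₂).mem 37 0 0 = _ :=
    (congrFun (congrFun (exec_mem_of_notMem (by decide) σ₂) 0) 0).trans b₁
  generalize (formProg 9 10 14 15 15 38).exec σ₂ = σ₃ at *
  set P := fillMat 9 10 7 (.div (.mul (ent 15 9) (.conj (ent 15 10))) (cell 36)) with hP
  have m₇ : HoldsMat ((P.exec σ₃).mem 7) Xs := by
    intro p q
    rw [hP, fillMat_mem (f := fun i j => σ₃.mem 15 i 0 * star (σ₃.mem 15 j 0) /
      (pairing D.budgetMat (outer u) : ℂ)) (by decide) (by decide) (by decide),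
      if_pos ⟨i₃.reg1 ▸ idx_lt p, i₃.reg1 ▸ idx_lt q⟩, u₃, u₃, hXs]
    · simp [outer_apply, div_eq_inv_mul]
    · intro i _ j _ τ hA h9 h10 _
      have m15 : τ.mem 15 = σ₃.mem 15 := hA.1 15 (by simp)
      have m36 : τ.mem 36 = σ₃.mem 36 := hA.1 36 (by simp)
      simp [Expr.eval, IdxExpr.eval, h9, h10, m15, m36, a₃]
  have i₄ := i₃.exec P (by decide) (by decide)
  have f₄ : ∀ a ∈ [36, 37, 38], (P.exec σ₃).mem a = σ₃.mem a :=
    fun a ha => exec_mem_of_notMem (by revert a; decide) _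
  generalize P.exec σ₃ = σ₄ at *
  rw [← f₄ _ (by simp)] at a₃ b₃ c₁
  have hpairs : ∀ N, pairing N Xs = pairing N (outer u) / pairing D.budgetMat (outer u) :=
    fun N => by rw [hXs, pairing_smul_right, div_eq_inv_mul]
  rw [hpairs, hpairs]
  refine ⟨fun p q => ?_, ?_, ?_⟩
  · rw [exec_mem_of_notMem (by decide), exec_mem_of_notMem (by decide)]
    exact m₇ p q
  · simp only [exec_store, store_mem, IdxExpr.eval, Expr.eval, a₃, b₃, i₄.params, listArray]
    simp [← Complex.ofReal_div]
  · simp only [exec_store, store_mem, IdxExpr.eval, Expr.eval]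
    simp [a₃, c₁, ← Complex.ofReal_div]

theorem hasData_input (D : RelayData K) (X : Var K) (b c : ℝ) :
    HasData D (squareProg.exec (input D X b c)) where
  reg0 := by rw [exec_reg_of_notMem (by decide)]; rfl
  reg1 := by rw [squareProg_reg]; rfl
  hS := by rw [exec_mem_of_notMem (by decide)]; rfl
  hJ := by rw [exec_mem_of_notMem (by decide)]; rfl
  hD := by rw [exec_mem_of_notMem (by decide)]; rfl
  hE := by rw [exec_mem_of_notMem (by decide)]; rfl
  params := by rw [exec_mem_of_notMem (by decide)]; rfl

theorem holdsMat_matArray (X : Var K) : HoldsMat (matArray X) X := by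
  intro p q
  rw [matArray, dif_pos ⟨idx_lt p, idx_lt q⟩]
  simp only [idx, Fin.eta, Equiv.symm_apply_apply]

theorem reductionProg_shows {D : RelayData K} (hD : D.Admissible) {X : Var K} {b c : ℝ}
    (hX : D.RelaxedOptimal X b c) :
    ∃ u : Fin K × Fin K → ℂ, D.Solves X u ∧ ∀ Xs : Var K,
      Xs = (((pairing D.budgetMat (outer u))⁻¹ : ℝ) : ℂ) • outer u →
      (reductionProg.exec (input D X b c)).Shows Xs
        (Real.sqrt (pairing D.powerMat Xs / D.PRmax)) (Real.sqrt (pairing D.jammerMat Xs)) := by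
  simp only [reductionProg, mainProg, exec_seq]
  have i₀ := hasData_input D X b c
  have f₀ : ∀ a, (squareProg.exec (input D X b c)).mem a = (input D X b c).mem a :=
    fun a => exec_mem_of_notMem (by simp [squareProg, Prog.arrs]) _
  generalize squareProg.exec (input D X b c) = σ₀ at *
  have i₁ := setupProg_holds i₀ (by rw [f₀]; rfl)
  have x₁ : HoldsMat ((setupProg.exec σ₀).mem 5) X := by
    rw [exec_mem_of_notMem (by decide), f₀]; exact holdsMat_matArray X
  have z₁ : (setupProg.exec σ₀).mem 15 = fun _ _ => 0 := by
    rw [exec_mem_of_notMem (by decide), f₀]; rfl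
  generalize setupProg.exec σ₀ = σ₁ at *
  obtain ⟨u, hu, hs⟩ := pivotLoop_holds hD hX i₁ x₁ z₁
  have i₂ := i₁.exec (.loop 8 (.reg 1) (.seq pivotProg mergeProg)) (by decide) (by decide)
  generalize (Prog.loop 8 (.reg 1) (.seq pivotProg mergeProg)).exec σ₁ = σ₂ at *
  obtain ⟨u', hu', hs'⟩ := repairProg_holds hD hX i₂ hu hs
  have i₃ := i₂.exec repairProg (by decide) (by decide)
  exact ⟨u', hs', fun Xs hXs => outputProg_shows i₃ hu' hXs⟩

end Program

end RAM

theorem theorem2 :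
    ∃ (prog : RAM.Prog) (C d : ℕ),
      ∀ (K : ℕ) (D : RelayData K),
        0 < D.PS → 0 < D.PJ → 0 < D.PRmax → 0 < D.ε → D.ε < 1 →
        ∀ (X : RelayData.Var K) (b c : ℝ), D.RelaxedOptimal X b c →
          ∃ (Xs : RelayData.Var K) (bs cs : ℝ),
            -- the answer is computed from the data and the given solution in polynomial time
            ((prog.run (RAM.input D X b c)).1.Shows Xs bs cs ∧
              (prog.run (RAM.input D X b c)).2 ≤ C * (K + 1) ^ d) ∧
            -- it is optimal for the relaxed program, and for the program with the rank constraint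
            D.RelaxedOptimal Xs bs cs ∧
            D.RankOptimal Xs bs cs ∧
            D.objective Xs = D.objective X ∧
            -- and it has rank one
            Xs.rank ≤ 1 ∧
            (b ≠ 0 → (2 ≤ K ∨ 0 < D.Q) → Xs.rank = 1) := by
  obtain ⟨C, d, htime⟩ := RAM.reductionProg_time
  refine ⟨RAM.reductionProg, C, d, fun K D hPS hPJ hPR hε _ X b c hX => ?_⟩
  have hD : D.Admissible := ⟨hPS, hPJ, hPR, hε⟩
  obtain ⟨u, hu, hshow⟩ := RAM.reductionProg_shows hD hX
  exact ⟨_, _, _, ⟨hshow _ rfl, htime K _ rfl⟩, hu.optimal hD hX rfl rfl rfl⟩
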